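/- **Conventions.** Everything is real and finite dimensional; Lie groups are smooth and not necessarily connected. The Lie bracket on the Lie algebra $T_eG$ of a Lie group $G$ is the bracket of right invariant vector fields. For $V\in\wedge^k T_eG$, $V^{\mathsf l}$ and $V^{\mathsf r}$ denote the left and right invariant $k$-vector fields with value $V$ at $e$; likewise $\xi^{\mathsf l}$, $\xi^{\mathsf r}$ for covectors. We write $\mathsf l_g,\mathsf r_g$ for left and right translation (and their differentials), and $a\wedge b=a\otimes b-b\otimes a$. A *Poisson Lie group* is a Lie group $G$ with a Poisson bivector field $\pi$ such that $\pi|_{gh}=\mathsf l_g(\pi|_h)+\mathsf r_h(\pi|_g)$ for all $g,h\in G$; its Lie bialgebra is $(\mathfrak g,\delta_*)$, where $\mathfrak g=T_eG$ and $\delta_*(u)\in\wedge^2\mathfrak g$ is the derivative at $e$ in the direction $u$ of $g\mapsto \mathsf r_{g^{-1}}(\pi|_g)$. A *Poisson Lie group homomorphism* is a Lie group homomorphism between Poisson Lie groups that is a Poisson map. Let $(\mathfrak g,\delta_*)$ be a Lie bialgebra, i.e. $\mathfrak g$ is a Lie algebra and $\delta_*:\mathfrak g\to\wedge^2\mathfrak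 g$ is a $1$-cocycle such that $[\xi,\eta]_{\mathfrak g^*}(u)=-\delta_*(u)(\xi,\eta)$ is a Lie bracket on $\mathfrak g^*$. Let $\mathfrak d=\mathfrak g\oplus\mathfrak g^*$ be its Drinfeld double Lie algebra, with the bracket $$[u+\xi,w+\eta]=[u,w]_{\mathfrak g}+\mathrm{ad}^*_\xi w-\mathrm{ad}^*_\eta u+[\xi,\eta]_{\mathfrak g^*}+\mathrm{ad}^*_u\eta-\mathrm{ad}^*_w\xi,$$ where $(\mathrm{ad}^*_u\xi)(w)=\xi([w,u]_{\mathfrak g})$ and $\eta(\mathrm{ad}^*_\xi u)=[\eta,\xi]_{\mathfrak g^*}(u)$, and with the invariant bilinear form $\langle u+\xi,w+\eta\rangle=\eta(u)+\xi(w)$. Let $\mathrm{pr}_{\mathfrak g},\mathrm{pr}_{\mathfrak g^*}$ be the projections of $\mathfrak d$ onto $\mathfrak g$ and $\mathfrak g^*$. Let $D$ be a Lie group with Lie algebra $\mathfrak d$ whose adjoint action on $\mathfrak d$ preserves $\langle\,,\rangle$, and put $$\pi_D=R^{\mathsf r}-R^{\mathsf l},\qquad R=\tfrac12\sum_i\xi_i\wedge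 u_i\in\wedge^2\mathfrak d,$$ where $(u_i)$ is any basis of $\mathfrak g$ and $(\xi_i)$ is the dual basis of $\mathfrak g^*$. Let $G$ and $G^*$ be Lie groups with Lie algebras $\mathfrak g$ and $\mathfrak g^*$, and let $\phi_G:G\to D$, $g\mapsto\bar g$, and $\phi_{G^*}:G^*\to D$, $v\mapsto\bar v$, be Lie group homomorphisms whose differentials at the identity are the inclusions $\mathfrak g\to\mathfrak d$ and $\mathfrak g^*\to\mathfrak d$. Define $\pi_G$ on $G$ and $\pi_{G^*}$ on $G^*$ by $$\pi_G|_g(\xi_1^{\mathsf l},\xi_2^{\mathsf l})=\langle\mathrm{pr}_{\mathfrak g}(\mathrm{Ad}_{\bar g}\xi_1),\mathrm{pr}_{\mathfrak g^*}(\mathrm{Ad}_{\bar g}\xi_2)\rangle,\qquad g\in G,\ \xi_1,\xi_2\in\mathfrak g^*,$$ $$\pi_{G^*}|_v(u_1^{\mathsf r},u_2^{\mathsf r})=\langle\mathrm{pr}_{\mathfrak g}(\mathrm{Ad}_{\bar v^{-1}}u_1),\mathrm{pr}_{\mathfrak g^*}(\mathrm{Ad}_{\bar v^{-1}}u_2)\rangle,\qquad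 v\in G^*,\ u_1,u_2\in\mathfrak g.$$ **Lemma.** Both $(G,\pi_G)$ and $(G^*,\pi_{G^*})$ are Poisson Lie groups, and $$\phi_G:(G,\pi_G)\to(D,\pi_D)\qquad\text{and}\qquad\phi_{G^*}:(G^*,\pi_{G^*})\to(D,-\pi_D)$$ are Poisson Lie group homomorphisms. Moreover, the Lie bialgebra of $(G,\pi_G)$ is $(\mathfrak g,\delta_*)$, and $(G^*,\pi_{G^*})$ is a dual Poisson Lie group of $(G,\pi_G)$, i.e. its Lie bialgebra is $(\mathfrak g^*,\delta)$ with $\delta(\xi)(u_1,u_2)=-\xi([u_1,u_2]_{\mathfrak g})$. -/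

import Mathlib

open scoped Manifold ContDiff


noncomputable section

/-! ### Lie bialgebras and their doubles -/

/-- The bracket `[ξ, η](u) = - δ(u)(ξ, η)` on `𝔤*` determined by a linear map `δ : 𝔤 → ⋀² 𝔤`,
where `δ u ξ η` is the value of the bivector `δ(u)` on the pair of covectors `ξ, η`. -/
def cobracketDual {𝔤 : Type*} [AddCommGroup 𝔤] [Module ℝ 𝔤]
    (δ : 𝔤 →ₗ[ℝ] LinearMap.BilinForm ℝ (Module.Dual ℝ 𝔤)) (ξ η : Module.Dual ℝ 𝔤) :
    Module.Dual ℝ 𝔤 :=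
  -(LinearMap.applyₗ η ∘ₗ LinearMap.applyₗ ξ ∘ₗ δ)

/-- A (real) Lie bialgebra structure on a Lie algebra `𝔤`. The cobracket `δ_* : 𝔤 → ⋀² 𝔤` is
recorded through the values `δ_*(u)(ξ, η)` of the bivector `δ_*(u)` on pairs of covectors. -/
structure LieBialgebra (𝔤 : Type*) [LieRing 𝔤] [LieAlgebra ℝ 𝔤] where
  /-- `cobracket u ξ η = δ_*(u)(ξ, η)` -/
  cobracket : 𝔤 →ₗ[ℝ] LinearMap.BilinForm ℝ (Module.Dual ℝ 𝔤)
  alt : ∀ u ξ, cobracket u ξ ξ = 0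
  /-- The Jacobi identity for the bracket on `𝔤*` determined by `δ_*`. -/
  jacobi : ∀ ξ η ζ : Module.Dual ℝ 𝔤,
    cobracketDual cobracket (cobracketDual cobracket ξ η) ζ +
      cobracketDual cobracket (cobracketDual cobracket η ζ) ξ +
      cobracketDual cobracket (cobracketDual cobracket ζ ξ) η = 0
  /-- `δ_*([u, w]) = ad_u δ_*(w) - ad_w δ_*(u)`. -/
  cocycle : ∀ (u w : 𝔤) (ξ η : Module.Dual ℝ 𝔤),
    cobracket ⁅u, w⁆ ξ η =
      (cobracket w (ξ ∘ₗ (LieAlgebra.ad ℝ 𝔤 u : 𝔤 →ₗ[ℝ] 𝔤)) η +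
        cobracket w ξ (η ∘ₗ (LieAlgebra.ad ℝ 𝔤 u : 𝔤 →ₗ[ℝ] 𝔤))) -
      (cobracket u (ξ ∘ₗ (LieAlgebra.ad ℝ 𝔤 w : 𝔤 →ₗ[ℝ] 𝔤)) η +
        cobracket u ξ (η ∘ₗ (LieAlgebra.ad ℝ 𝔤 w : 𝔤 →ₗ[ℝ] 𝔤)))

namespace LieBialgebra

variable {𝔤 : Type*} [LieRing 𝔤] [LieAlgebra ℝ 𝔤] (B : LieBialgebra 𝔤)

theorem cobracket_swap (u : 𝔤) (ξ η : Module.Dual ℝ 𝔤) :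
    B.cobracket u ξ η = - B.cobracket u η ξ := by
  have h := B.alt u (ξ + η)
  simp only [map_add, LinearMap.add_apply, B.alt] at h
  linarith

/-- The dual Lie algebra `𝔤*` of a Lie bialgebra, as a copy of the dual vector space. -/
def DualAlg (_ : LieBialgebra 𝔤) : Type _ := Module.Dual ℝ 𝔤

instance : AddCommGroup B.DualAlg := inferInstanceAs (AddCommGroup (Module.Dual ℝ 𝔤))
instance : Module ℝ B.DualAlg := inferInstanceAs (Module ℝ (Module.Dual ℝ 𝔤))

/-- `B.DualAlg` is `𝔤*` as a vector space. -/
def toDual : B.DualAlg ≃ₗ[ℝ] Module.Dual ℝ 𝔤 := LinearEquiv.refl ℝ _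

/-- The bracket of `𝔤*`, given by `[ξ, η](u) = - δ_*(u)(ξ, η)`. -/
instance : Bracket B.DualAlg B.DualAlg where
  bracket ξ η := B.toDual.symm (cobracketDual B.cobracket (B.toDual ξ) (B.toDual η))

theorem toDual_lie (ξ η : B.DualAlg) (u : 𝔤) :
    B.toDual ⁅ξ, η⁆ u = - B.cobracket u (B.toDual ξ) (B.toDual η) := rfl

theorem dual_ext {ξ η : B.DualAlg} (h : ∀ u, B.toDual ξ u = B.toDual η u) : ξ = η :=
  B.toDual.injective (LinearMap.ext h)

instance : LieRing B.DualAlg where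
  add_lie ξ η ζ := B.dual_ext fun u => by
    simp only [toDual_lie, map_add, LinearMap.add_apply]; ring
  lie_add ξ η ζ := B.dual_ext fun u => by
    simp only [toDual_lie, map_add, LinearMap.add_apply]; ring
  lie_self ξ := B.dual_ext fun u => by
    simp [toDual_lie, B.alt]
  leibniz_lie ξ η ζ := B.dual_ext fun u => by
    have h := LinearMap.congr_fun (B.jacobi (B.toDual ξ) (B.toDual η) (B.toDual ζ)) u
    change B.toDual ⁅⁅ξ, η⁆, ζ⁆ u + B.toDual ⁅⁅η, ζ⁆, ξ⁆ u + B.toDual ⁅⁅ζ, ξ⁆, η⁆ u = 0 at h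
    have h' : B.toDual ⁅ζ, ξ⁆ = - B.toDual ⁅ξ, ζ⁆ := by
      ext w
      simp only [LinearMap.neg_apply, toDual_lie]
      rw [B.cobracket_swap]
    simp only [map_add, LinearMap.add_apply]
    simp only [toDual_lie _ ⁅_, _⁆, toDual_lie _ _ ⁅_, _⁆, h', map_neg, LinearMap.neg_apply]
      at h ⊢
    rw [B.cobracket_swap u (B.toDual ⁅η, ζ⁆), B.cobracket_swap u (B.toDual ⁅ξ, ζ⁆)] at h
    linarith

instance : LieAlgebra ℝ B.DualAlg where
  lie_smul t ξ η := B.dual_ext fun u => by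
    simp [toDual_lie]

variable [FiniteDimensional ℝ 𝔤]

/-- The element of `𝔤` represented by a linear form on `𝔤*`. -/
def ofBidual : Module.Dual ℝ B.DualAlg ≃ₗ[ℝ] 𝔤 :=
  (B.toDual.dualMap.symm).trans (Module.evalEquiv ℝ 𝔤).symm

@[simp] theorem toDual_ofBidual (ξ : B.DualAlg) (a : Module.Dual ℝ B.DualAlg) :
    B.toDual ξ (B.ofBidual a) = a ξ := by
  have : Module.evalEquiv ℝ 𝔤 (B.ofBidual a) = B.toDual.dualMap.symm a := by
    simp [ofBidual]
  have h2 := LinearMap.congr_fun this (B.toDual ξ)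
  simpa using h2

theorem ofBidual_eq (a : Module.Dual ℝ B.DualAlg) (u : 𝔤)
    (h : ∀ ξ, a ξ = B.toDual ξ u) : B.ofBidual a = u := by
  apply (Module.evalEquiv ℝ 𝔤).injective
  ext ξ
  have := B.toDual_ofBidual (B.toDual.symm ξ) a
  simp only [LinearEquiv.apply_symm_apply] at this
  simp [this, h]

/-- The map `δ : 𝔤* → ⋀² 𝔤*`, `δ(ξ)(u₁, u₂) = - ξ([u₁, u₂])`, where `u₁, u₂ ∈ 𝔤` are regarded
as linear forms on `𝔤*`. -/
def dualCobracket : B.DualAlg →ₗ[ℝ] LinearMap.BilinForm ℝ (Module.Dual ℝ B.DualAlg) :=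
  LinearMap.mk₂ ℝ (fun ξ a => -(B.toDual ξ ∘ₗ
      (LieAlgebra.ad ℝ 𝔤 (B.ofBidual a) : 𝔤 →ₗ[ℝ] 𝔤) ∘ₗ B.ofBidual.toLinearMap))
    (by intros; ext; simp; ring) (by intros; ext; simp)
    (by intros; ext; simp; ring) (by intros; ext; simp)

theorem dualCobracket_apply (ξ : B.DualAlg) (a b : Module.Dual ℝ B.DualAlg) :
    B.dualCobracket ξ a b = - B.toDual ξ ⁅B.ofBidual a, B.ofBidual b⁆ := rfl

theorem ofBidual_cobracketDual (a b : Module.Dual ℝ B.DualAlg) :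
    B.ofBidual (cobracketDual B.dualCobracket a b) = ⁅B.ofBidual a, B.ofBidual b⁆ :=
  B.ofBidual_eq _ _ fun ξ => by simp [cobracketDual, dualCobracket_apply]

theorem toDual_lie_ofBidual (ζ χ : B.DualAlg) (c : Module.Dual ℝ B.DualAlg) (x : 𝔤) :
    B.toDual ζ ⁅B.ofBidual (c ∘ₗ (LieAlgebra.ad ℝ B.DualAlg χ : B.DualAlg →ₗ[ℝ] B.DualAlg)), x⁆ =
      B.cobracket (B.ofBidual c) (B.toDual χ)
        (B.toDual ζ ∘ₗ (LieAlgebra.ad ℝ 𝔤 x : 𝔤 →ₗ[ℝ] 𝔤)) := by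
  have h := B.toDual_ofBidual (B.toDual.symm
    (B.toDual ζ ∘ₗ (LieAlgebra.ad ℝ 𝔤 x : 𝔤 →ₗ[ℝ] 𝔤)))
    (c ∘ₗ (LieAlgebra.ad ℝ B.DualAlg χ : B.DualAlg →ₗ[ℝ] B.DualAlg))
  simp only [LinearEquiv.apply_symm_apply, LinearMap.comp_apply, LieAlgebra.ad_apply] at h
  rw [← lie_skew, map_neg, h, ← B.toDual_ofBidual, toDual_lie]
  simp

/-- The dual Lie bialgebra `(𝔤*, δ)`. -/
def dual : LieBialgebra B.DualAlg where
  cobracket := B.dualCobracket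
  alt := by intros; simp [dualCobracket_apply]
  jacobi := by
    intro a b c
    apply B.ofBidual.injective
    simp only [map_add, ofBidual_cobracketDual, map_zero]
    have h := lie_jacobi (B.ofBidual a) (B.ofBidual b) (B.ofBidual c)
    rw [← lie_skew ⁅B.ofBidual a, B.ofBidual b⁆, ← lie_skew ⁅B.ofBidual b, B.ofBidual c⁆,
      ← lie_skew ⁅B.ofBidual c, B.ofBidual a⁆, ← neg_eq_zero, ← h]
    abel
  cocycle := by
    intro ξ η a b
    simp only [dualCobracket_apply]
    rw [← lie_skew (B.ofBidual a) (B.ofBidual (b ∘ₗ _)),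
      ← lie_skew (B.ofBidual a) (B.ofBidual (b ∘ₗ _)), map_neg, map_neg]
    simp only [toDual_lie_ofBidual]
    rw [toDual_lie, B.cocycle, B.cobracket_swap (B.ofBidual a) _ (B.toDual η),
      B.cobracket_swap (B.ofBidual b) _ (B.toDual η)]
    ring

/-- The vector space `𝔡 = 𝔤 ⊕ 𝔤*` underlying the Drinfeld double. -/
def Double (B : LieBialgebra 𝔤) : Type _ := 𝔤 × B.DualAlg

instance : AddCommGroup B.Double := inferInstanceAs (AddCommGroup (𝔤 × B.DualAlg))
instance : Module ℝ B.Double := inferInstanceAs (Module ℝ (𝔤 × B.DualAlg))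

/-- The inclusion `𝔤 → 𝔡`. -/
def inl : 𝔤 →ₗ[ℝ] B.Double := LinearMap.inl ℝ 𝔤 B.DualAlg

/-- The inclusion `𝔤* → 𝔡`. -/
def inr : B.DualAlg →ₗ[ℝ] B.Double := LinearMap.inr ℝ 𝔤 B.DualAlg

/-- The projection `𝔡 → 𝔤`. -/
def prg : B.Double →ₗ[ℝ] 𝔤 := LinearMap.fst ℝ 𝔤 B.DualAlg

/-- The projection `𝔡 → 𝔤*`. -/
def prgs : B.Double →ₗ[ℝ] B.DualAlg := LinearMap.snd ℝ 𝔤 B.DualAlg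

/-- The pairing `⟨u + ξ, w + η⟩ = η(u) + ξ(w)` on `𝔡`. -/
def pairing : LinearMap.BilinForm ℝ B.Double :=
  LinearMap.mk₂ ℝ (fun a b => B.toDual (B.prgs b) (B.prg a) + B.toDual (B.prgs a) (B.prg b))
    (by intros; simp only [map_add, LinearMap.add_apply]; ring)
    (by intros; simp only [map_smul, LinearMap.smul_apply, smul_eq_mul]; ring)
    (by intros; simp only [map_add, LinearMap.add_apply]; ring)
    (by intros; simp only [map_smul, LinearMap.smul_apply, smul_eq_mul]; ring)

/-- `ad_u^* ξ ∈ 𝔤*`, given by `(ad_u^* ξ)(w) = ξ([w, u])`. -/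
def coad (u : 𝔤) (ξ : B.DualAlg) : B.DualAlg :=
  B.toDual.symm (-(B.toDual ξ ∘ₗ (LieAlgebra.ad ℝ 𝔤 u : 𝔤 →ₗ[ℝ] 𝔤)))

theorem coad_apply (u : 𝔤) (ξ : B.DualAlg) (w : 𝔤) :
    B.toDual (B.coad u ξ) w = B.toDual ξ ⁅w, u⁆ := by
  rw [← lie_skew, map_neg]; rfl

/-- `ad_ξ^* u ∈ 𝔤`, given by `η(ad_ξ^* u) = [η, ξ](u)`. -/
def coadDual (ξ : B.DualAlg) (u : 𝔤) : 𝔤 :=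
  B.ofBidual (-((LinearMap.applyₗ u) ∘ₗ B.toDual.toLinearMap ∘ₗ
    (LieAlgebra.ad ℝ B.DualAlg ξ : B.DualAlg →ₗ[ℝ] B.DualAlg)))

theorem coadDual_apply (ξ : B.DualAlg) (u : 𝔤) (η : B.DualAlg) :
    B.toDual η (B.coadDual ξ u) = B.toDual ⁅η, ξ⁆ u := by
  rw [coadDual, toDual_ofBidual, ← lie_skew, map_neg]; rfl

/-- The bracket of the Drinfeld double:
`[u + ξ, w + η] = [u, w] + ad_ξ^* w - ad_η^* u + [ξ, η] + ad_u^* η - ad_w^* ξ`. -/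
instance : Bracket B.Double B.Double where
  bracket a b :=
    (⁅B.prg a, B.prg b⁆ + B.coadDual (B.prgs a) (B.prg b) - B.coadDual (B.prgs b) (B.prg a),
     ⁅B.prgs a, B.prgs b⁆ + B.coad (B.prg a) (B.prgs b) - B.coad (B.prg b) (B.prgs a))

theorem prg_lie (a b : B.Double) : B.prg ⁅a, b⁆ =
    ⁅B.prg a, B.prg b⁆ + B.coadDual (B.prgs a) (B.prg b) - B.coadDual (B.prgs b) (B.prg a) := rfl

theorem prgs_lie (a b : B.Double) : B.prgs ⁅a, b⁆ =
    ⁅B.prgs a, B.prgs b⁆ + B.coad (B.prg a) (B.prgs b) - B.coad (B.prg b) (B.prgs a) := rfl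

theorem double_ext {a b : B.Double} (h₁ : ∀ ξ, B.toDual ξ (B.prg a) = B.toDual ξ (B.prg b))
    (h₂ : ∀ u, B.toDual (B.prgs a) u = B.toDual (B.prgs b) u) : a = b := by
  refine Prod.ext ?_ (B.dual_ext h₂)
  change B.prg a = B.prg b
  apply (Module.evalEquiv ℝ 𝔤).injective
  ext ξ
  simpa using h₁ (B.toDual.symm ξ)

theorem cocycle_coad (u w : 𝔤) (ξ η : B.DualAlg) :
    B.cobracket ⁅u, w⁆ (B.toDual ξ) (B.toDual η) =
      -(B.cobracket w (B.toDual (B.coad u ξ)) (B.toDual η) +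
        B.cobracket w (B.toDual ξ) (B.toDual (B.coad u η))) +
      (B.cobracket u (B.toDual (B.coad w ξ)) (B.toDual η) +
        B.cobracket u (B.toDual ξ) (B.toDual (B.coad w η))) := by
  have h : ∀ (x : 𝔤) (ζ : B.DualAlg), B.toDual ζ ∘ₗ (LieAlgebra.ad ℝ 𝔤 x : 𝔤 →ₗ[ℝ] 𝔤) =
      - B.toDual (B.coad x ζ) := fun x ζ => by simp [coad]
  rw [B.cocycle, h, h, h, h]
  simp only [map_neg, LinearMap.neg_apply]
  ring

theorem pairing_apply (a b : B.Double) : B.pairing a b =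
    B.toDual (B.prgs b) (B.prg a) + B.toDual (B.prgs a) (B.prg b) := rfl

theorem pairing_lie (a b c : B.Double) : B.pairing ⁅a, b⁆ c = B.pairing a ⁅b, c⁆ := by
  simp only [pairing_apply, prg_lie, prgs_lie, map_add, map_sub, LinearMap.add_apply,
    LinearMap.sub_apply, coad_apply, coadDual_apply, toDual_lie]
  rw [← lie_skew (B.prg c) (B.prg a), ← lie_skew (B.prg c) (B.prg b), map_neg, map_neg,
    B.cobracket_swap (B.prg b) (B.toDual (B.prgs c)),
    B.cobracket_swap (B.prg a) (B.toDual (B.prgs c))]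
  ring

theorem double_skew (a b : B.Double) : ⁅a, b⁆ = -⁅b, a⁆ := by
  apply B.double_ext <;> intro x
  · rw [map_neg, prg_lie, prg_lie, ← lie_skew (B.prg a)]; congr 1; abel
  · rw [map_neg, prgs_lie, prgs_lie, ← lie_skew (B.prgs a)]; congr 2; abel

theorem pairing_nondeg {a b : B.Double} (h : ∀ d, B.pairing a d = B.pairing b d) : a = b := by
  apply B.double_ext <;> intro x
  · have h1 := h (B.inr x)
    rw [pairing_apply, pairing_apply, show B.prg (B.inr x) = 0 from rfl,
      show B.prgs (B.inr x) = x from rfl] at h1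
    simpa using h1
  · have h1 := h (B.inl x)
    rw [pairing_apply, pairing_apply, show B.prg (B.inl x) = x from rfl,
      show B.prgs (B.inl x) = 0 from rfl] at h1
    simpa using h1

theorem pairing_jacobi (a b c d : B.Double) :
    B.pairing ⁅a, b⁆ ⁅c, d⁆ + B.pairing ⁅b, c⁆ ⁅a, d⁆ + B.pairing ⁅c, a⁆ ⁅b, d⁆ = 0 := by
  obtain ⟨u, hu⟩ : ∃ u, B.prg a = u := ⟨_, rfl⟩
  obtain ⟨v, hv⟩ : ∃ u, B.prg b = u := ⟨_, rfl⟩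
  obtain ⟨w, hw⟩ : ∃ u, B.prg c = u := ⟨_, rfl⟩
  obtain ⟨x, hx⟩ : ∃ u, B.prg d = u := ⟨_, rfl⟩
  obtain ⟨α, hα⟩ : ∃ u, B.prgs a = u := ⟨_, rfl⟩
  obtain ⟨β, hβ⟩ : ∃ u, B.prgs b = u := ⟨_, rfl⟩
  obtain ⟨γ, hγ⟩ : ∃ u, B.prgs c = u := ⟨_, rfl⟩
  obtain ⟨δ, hδ⟩ : ∃ u, B.prgs d = u := ⟨_, rfl⟩
  have jac : ∀ (ζ : B.DualAlg) (p q r : 𝔤), B.toDual ζ ⁅⁅p, q⁆, r⁆ + B.toDual ζ ⁅⁅q, r⁆, p⁆ +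
      B.toDual ζ ⁅⁅r, p⁆, q⁆ = 0 := fun ζ p q r => by
    have h := congrArg (B.toDual ζ) (lie_jacobi p q r)
    rw [← lie_skew ⁅p, q⁆, ← lie_skew ⁅q, r⁆, ← lie_skew ⁅r, p⁆]
    simp only [map_add, map_neg, map_zero] at h ⊢
    linarith
  have jac' : ∀ (ζ : B.DualAlg) (p q r : 𝔤), B.toDual ζ ⁅⁅p, q⁆, r⁆ + B.toDual ζ ⁅⁅q, r⁆, p⁆ -
      B.toDual ζ ⁅⁅p, r⁆, q⁆ = 0 := fun ζ p q r => by
    have h := jac ζ p q r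
    rw [← lie_skew r p, neg_lie, map_neg] at h
    linarith
  have djac : ∀ (p : 𝔤) (ζ η χ : B.DualAlg), B.toDual ⁅⁅ζ, η⁆, χ⁆ p + B.toDual ⁅⁅η, χ⁆, ζ⁆ p +
      B.toDual ⁅⁅χ, ζ⁆, η⁆ p = 0 := fun p ζ η χ =>
    LinearMap.congr_fun (B.jacobi (B.toDual ζ) (B.toDual η) (B.toDual χ)) p
  have djac' : ∀ (p : 𝔤) (ζ η χ : B.DualAlg), B.toDual ⁅⁅ζ, η⁆, χ⁆ p + B.toDual ⁅⁅η, χ⁆, ζ⁆ p -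
      B.toDual ⁅⁅ζ, χ⁆, η⁆ p = 0 := fun p ζ η χ => by
    have h := djac p ζ η χ
    rw [← lie_skew χ ζ, neg_lie, map_neg, LinearMap.neg_apply] at h
    linarith
  have swap : ∀ (p q : 𝔤) (ζ η : B.DualAlg), B.toDual ⁅ζ, B.coad p η⁆ q =
      - B.toDual ⁅B.coad p η, ζ⁆ q := fun p q ζ η => by
    rw [← lie_skew, map_neg, LinearMap.neg_apply]
  have coc : ∀ (p q : 𝔤) (ζ η : B.DualAlg), B.toDual ⁅ζ, η⁆ ⁅p, q⁆ =
      - B.toDual ⁅B.coad p ζ, η⁆ q + B.toDual ⁅B.coad p η, ζ⁆ q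
      + B.toDual ⁅B.coad q ζ, η⁆ p - B.toDual ⁅B.coad q η, ζ⁆ p := fun p q ζ η => by
    have h := B.cocycle_coad p q ζ η
    have e1 := swap p q ζ η
    have e2 := swap q p ζ η
    simp only [toDual_lie] at e1 e2 ⊢
    linarith
  simp only [pairing_apply, prg_lie, prgs_lie, map_add, map_sub, LinearMap.add_apply,
    LinearMap.sub_apply, coad_apply, coadDual_apply, hu, hv, hw, hx, hα, hβ, hγ, hδ, coc]
  linear_combination jac δ u v w - jac' γ u v x - jac' α v w x - jac' β w u x +
    djac x α β γ - djac' w α β δ - djac' u β γ δ - djac' v γ α δ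

instance : LieRing B.Double where
  add_lie a b c := by
    apply B.double_ext <;> intro x <;>
    simp only [prg_lie, prgs_lie, map_add, map_sub, LinearMap.add_apply, LinearMap.sub_apply,
      coad_apply, coadDual_apply, add_lie, lie_add] <;> ring
  lie_add a b c := by
    apply B.double_ext <;> intro x <;>
    simp only [prg_lie, prgs_lie, map_add, map_sub, LinearMap.add_apply, LinearMap.sub_apply,
      coad_apply, coadDual_apply, lie_add] <;> ring
  lie_self a := by
    apply B.double_ext <;> intro x <;>
    simp [prg_lie, prgs_lie]
  leibniz_lie a b c := B.pairing_nondeg fun d => by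
    have h := B.pairing_jacobi a b c d
    rw [B.double_skew a ⁅b, c⁆, B.double_skew b ⁅a, c⁆]
    rw [B.double_skew c a] at h
    simp only [map_add, LinearMap.add_apply, map_neg, LinearMap.neg_apply, pairing_lie] at h ⊢
    linarith

instance : LieAlgebra ℝ B.Double where
  lie_smul t a b := by
    apply B.double_ext <;> intro x <;>
    simp only [prg_lie, prgs_lie, map_add, map_sub, LinearMap.add_apply, LinearMap.sub_apply,
      coad_apply, coadDual_apply, map_smul, LinearMap.smul_apply, lie_smul,
      smul_eq_mul] <;> ring

end LieBialgebra

/-! ### Poisson structures and Poisson Lie groups -/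

namespace PoissonLie

section Manifold

variable (E : Type*) [NormedAddCommGroup E] [NormedSpace ℝ E]
  (M : Type*) [TopologicalSpace M] [ChartedSpace E M]

/-- A field of contravariant `2`-tensors on `M`, given at each point as a bilinear form on the
cotangent space. -/
abbrev TensorField : Type _ :=
  ∀ x : M, LinearMap.BilinForm ℝ (Module.Dual ℝ (TangentSpace 𝓘(ℝ, E) x))

variable {M}

/-- The differential of a function, as a covector. -/
def dfun (f : M → ℝ) (x : M) : Module.Dual ℝ (TangentSpace 𝓘(ℝ, E) x) :=
  (mfderiv 𝓘(ℝ, E) 𝓘(ℝ, ℝ) f x : TangentSpace 𝓘(ℝ, E) x →L[ℝ] ℝ).toLinearMap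

variable {E}

/-- The bracket `{f, h} = π(df, dh)`. -/
def poissonBracket (π : TensorField E M) (f h : M → ℝ) (x : M) : ℝ :=
  π x (dfun E f x) (dfun E h x)

/-- `f` is smooth near `x`. -/
abbrev SmoothAt (E : Type*) [NormedAddCommGroup E] [NormedSpace ℝ E] {M : Type*}
    [TopologicalSpace M] [ChartedSpace E M] (f : M → ℝ) (x : M) : Prop :=
  ContMDiffAt 𝓘(ℝ, E) 𝓘(ℝ, ℝ) ∞ f x

/-- `π` is a Poisson structure: a skew-symmetric and smooth tensor field (i.e. a bivector field)
such that `{f, h} = π(df, dh)` satisfies the Jacobi identity, for all (locally defined) smooth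
functions. -/
structure IsPoisson (π : TensorField E M) : Prop where
  alt : ∀ x α, π x α α = 0
  smooth : ∀ x f h, SmoothAt E f x → SmoothAt E h x → SmoothAt E (poissonBracket π f h) x
  jacobi : ∀ x f g h, SmoothAt E f x → SmoothAt E g x → SmoothAt E h x →
    poissonBracket π f (poissonBracket π g h) x + poissonBracket π g (poissonBracket π h f) x +
      poissonBracket π h (poissonBracket π f g) x = 0

end Manifold

section Group

variable {E : Type*} [NormedAddCommGroup E] [NormedSpace ℝ E]
  {G : Type*} [TopologicalSpace G] [ChartedSpace E G] [Group G]

variable (E) in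
/-- The differential at `x` of the left translation `l_g`. -/
def dLeft (g x : G) : TangentSpace 𝓘(ℝ, E) x →ₗ[ℝ] TangentSpace 𝓘(ℝ, E) (g * x) :=
  (mfderiv 𝓘(ℝ, E) 𝓘(ℝ, E) (fun y : G => g * y) x).toLinearMap

variable (E) in
/-- The differential at `x` of the right translation `r_g`. -/
def dRight (g x : G) : TangentSpace 𝓘(ℝ, E) x →ₗ[ℝ] TangentSpace 𝓘(ℝ, E) (x * g) :=
  (mfderiv 𝓘(ℝ, E) 𝓘(ℝ, E) (fun y : G => y * g) x).toLinearMap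

variable (E) in
/-- The differential at the identity of `l_g`, with target `T_g G`. -/
def leftTriv (g : G) : GroupLieAlgebra 𝓘(ℝ, E) G →ₗ[ℝ] TangentSpace 𝓘(ℝ, E) g :=
  dLeft E g 1

variable (E) in
/-- The differential at the identity of `r_g`, with target `T_g G`. -/
def rightTriv (g : G) : GroupLieAlgebra 𝓘(ℝ, E) G →ₗ[ℝ] TangentSpace 𝓘(ℝ, E) g :=
  dRight E g 1

variable (E) in
/-- The differential of `r_{g⁻¹}` at `g`, with target `T_e G`. -/
def rightTrivInv (g : G) : TangentSpace 𝓘(ℝ, E) g →ₗ[ℝ] GroupLieAlgebra 𝓘(ℝ, E) G :=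
  dRight E g⁻¹ g

variable (E) in
/-- The adjoint action of `G` on `T_e G`: the differential at `e` of `x ↦ g x g⁻¹`. -/
def Ad (g : G) : GroupLieAlgebra 𝓘(ℝ, E) G →ₗ[ℝ] GroupLieAlgebra 𝓘(ℝ, E) G :=
  (mfderiv 𝓘(ℝ, E) 𝓘(ℝ, E) (fun x : G => g * x * g⁻¹) 1).toLinearMap

/-- The right invariant vector field `u^r`. -/
def rightInvariantVectorField (u : GroupLieAlgebra 𝓘(ℝ, E) G) (g : G) :
    TangentSpace 𝓘(ℝ, E) g :=
  rightTriv E g u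

variable (E G) in
/-- An identification of the Lie algebra of `G` with `𝔞`. The convention is that the bracket on
`T_e G` is the bracket of *right* invariant vector fields (the opposite of Mathlib's bracket on
`GroupLieAlgebra`). -/
structure LieAlgebraIdent (𝔞 : Type*) [LieRing 𝔞] [LieAlgebra ℝ 𝔞] where
  /-- the underlying linear isomorphism -/
  equiv : 𝔞 ≃ₗ[ℝ] GroupLieAlgebra 𝓘(ℝ, E) G
  map_lie : ∀ a b : 𝔞, equiv ⁅a, b⁆ =
    VectorField.mlieBracket 𝓘(ℝ, E) (rightInvariantVectorField (equiv a))
      (rightInvariantVectorField (equiv b)) (1 : G)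

/-- The adjoint action of `G` on `𝔞`, when `𝔞` is identified with the Lie algebra of `G`. -/
def LieAlgebraIdent.Ad {𝔞 : Type*} [LieRing 𝔞] [LieAlgebra ℝ 𝔞] (e : LieAlgebraIdent E G 𝔞)
    (g : G) : 𝔞 →ₗ[ℝ] 𝔞 :=
  e.equiv.symm.toLinearMap ∘ₗ PoissonLie.Ad E g ∘ₗ e.equiv.toLinearMap

/-- `π_{gh} = l_g(π_h) + r_h(π_g)`. -/
def IsMultiplicative (π : TensorField E G) : Prop :=
  ∀ (g h : G) (α β : Module.Dual ℝ (TangentSpace 𝓘(ℝ, E) (g * h))),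
    π (g * h) α β = π h (α ∘ₗ dLeft E g h) (β ∘ₗ dLeft E g h) +
      π g (α ∘ₗ dRight E h g) (β ∘ₗ dRight E h g)

/-- `(G, π)` is a Poisson Lie group. -/
structure IsPoissonLieGroup [LieGroup 𝓘(ℝ, E) ∞ G] (π : TensorField E G) : Prop where
  poisson : IsPoisson π
  multiplicative : IsMultiplicative π

/-- The value at `g` of the right trivialized tensor field `r_{g⁻¹}(π_g)` on two covectors
at the identity. -/
def rightTrivialized (π : TensorField E G)
    (α β : Module.Dual ℝ (GroupLieAlgebra 𝓘(ℝ, E) G)) (g : G) : ℝ :=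
  π g (α ∘ₗ rightTrivInv E g) (β ∘ₗ rightTrivInv E g)

/-- The Lie algebra of `G` being identified with `𝔤`, the Lie bialgebra of `(G, π)` is `B`: the
linearization of `π` at `e`, i.e. the derivative at `e` of `g ↦ r_{g⁻¹}(π_g)`, is the cobracket
of `B`. -/
def HasLieBialgebra {𝔤 : Type*} [LieRing 𝔤] [LieAlgebra ℝ 𝔤] (e : LieAlgebraIdent E G 𝔤)
    (π : TensorField E G) (B : LieBialgebra 𝔤) : Prop :=
  ∀ α β : Module.Dual ℝ (GroupLieAlgebra 𝓘(ℝ, E) G),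
    MDifferentiableAt 𝓘(ℝ, E) 𝓘(ℝ, ℝ) (rightTrivialized π α β) 1 ∧
    ∀ u : 𝔤, dfun E (rightTrivialized π α β) 1 (e.equiv u) =
      B.cobracket u (α ∘ₗ e.equiv.toLinearMap) (β ∘ₗ e.equiv.toLinearMap)

/-- `(G', π')` is a dual Poisson Lie group of the Poisson Lie group `(G, π)` with Lie bialgebra
`B`: it is a Poisson Lie group with Lie bialgebra `B.dual`. -/
structure IsDualPoissonLieGroup {𝔤 : Type*} [LieRing 𝔤] [LieAlgebra ℝ 𝔤] [FiniteDimensional ℝ 𝔤]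
    {E' : Type*} [NormedAddCommGroup E'] [NormedSpace ℝ E']
    {G' : Type*} [TopologicalSpace G'] [ChartedSpace E' G'] [Group G']
    [LieGroup 𝓘(ℝ, E) ∞ G] [LieGroup 𝓘(ℝ, E') ∞ G']
    (B : LieBialgebra 𝔤)
    (e : LieAlgebraIdent E G 𝔤) (π : TensorField E G)
    (e' : LieAlgebraIdent E' G' B.DualAlg) (π' : TensorField E' G') : Prop where
  poissonLie : IsPoissonLieGroup π
  bialgebra : HasLieBialgebra e π B
  poissonLie' : IsPoissonLieGroup π'
  bialgebra' : HasLieBialgebra e' π' B.dual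

variable {E' : Type*} [NormedAddCommGroup E'] [NormedSpace ℝ E']
  {D : Type*} [TopologicalSpace D] [ChartedSpace E' D] [Group D]

variable (E E') in
/-- The differential of `φ : G → D` at `g`. -/
def dmap (φ : G → D) (g : G) :
    TangentSpace 𝓘(ℝ, E) g →ₗ[ℝ] TangentSpace 𝓘(ℝ, E') (φ g) :=
  (mfderiv 𝓘(ℝ, E) 𝓘(ℝ, E') φ g).toLinearMap

variable (E E') in
/-- The differential of a group homomorphism at the identity. -/
def dmapOne (φ : G →* D) : GroupLieAlgebra 𝓘(ℝ, E) G →ₗ[ℝ] GroupLieAlgebra 𝓘(ℝ, E') D :=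
  dmap E E' φ 1

/-- `φ : (G, π) → (D, ϖ)` is a homomorphism of Poisson Lie groups: a smooth group homomorphism
between Poisson Lie groups that is a Poisson map. -/
structure IsPoissonLieGroupHom [LieGroup 𝓘(ℝ, E) ∞ G] [LieGroup 𝓘(ℝ, E') ∞ D]
    (π : TensorField E G) (ϖ : TensorField E' D) (φ : G →* D) : Prop where
  source : IsPoissonLieGroup π
  target : IsPoissonLieGroup ϖ
  smooth : ContMDiff 𝓘(ℝ, E) 𝓘(ℝ, E') ∞ φ
  map : ∀ (g : G) (α β : Module.Dual ℝ (TangentSpace 𝓘(ℝ, E') (φ g))),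
    ϖ (φ g) α β = π g (α ∘ₗ dmap E E' φ g) (β ∘ₗ dmap E E' φ g)

/-- `φ : G → D` is an integration of the linear map `f : 𝔞 → 𝔟` of Lie algebras: a smooth group
homomorphism whose differential at the identity is `f`. -/
structure IsIntegration {𝔞 𝔟 : Type*} [LieRing 𝔞] [LieAlgebra ℝ 𝔞] [LieRing 𝔟] [LieAlgebra ℝ 𝔟]
    (e : LieAlgebraIdent E G 𝔞) (e' : LieAlgebraIdent E' D 𝔟) (f : 𝔞 →ₗ[ℝ] 𝔟)
    (φ : G →* D) : Prop where
  smooth : ContMDiff 𝓘(ℝ, E) 𝓘(ℝ, E') ∞ φ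
  deriv : ∀ a : 𝔞, dmapOne E E' φ (e.equiv a) = e'.equiv (f a)

end Group

/-! ### The bivector fields on `D`, `G` and `G*` -/

section Double

variable {𝔤 : Type*} [LieRing 𝔤] [LieAlgebra ℝ 𝔤] [FiniteDimensional ℝ 𝔤] (B : LieBialgebra 𝔤)
  {ED : Type*} [NormedAddCommGroup ED] [NormedSpace ℝ ED]
  {D : Type*} [TopologicalSpace D] [ChartedSpace ED D] [Group D]
  {EG : Type*} [NormedAddCommGroup EG] [NormedSpace ℝ EG]
  {G : Type*} [TopologicalSpace G] [ChartedSpace EG G] [Group G]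

/-- The bivector `a ∧ b = a ⊗ b - b ⊗ a`, evaluated on pairs of covectors. -/
def wedge {V : Type*} [AddCommGroup V] [Module ℝ V] (a b : V) :
    LinearMap.BilinForm ℝ (Module.Dual ℝ V) :=
  LinearMap.BilinForm.linMulLin (Module.Dual.eval ℝ V a) (Module.Dual.eval ℝ V b) -
    LinearMap.BilinForm.linMulLin (Module.Dual.eval ℝ V b) (Module.Dual.eval ℝ V a)

/-- `R = ½ ∑ ξ_i ∧ u_i ∈ ⋀² 𝔡`, where `u_i` is a basis of `𝔤` and `ξ_i` the dual basis. -/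
def rmatrix {ι : Type*} [Fintype ι] (u : Module.Basis ι ℝ 𝔤) :
    LinearMap.BilinForm ℝ (Module.Dual ℝ B.Double) :=
  (1 / 2 : ℝ) • ∑ i, wedge (B.inr (B.toDual.symm (u.coord i))) (B.inl (u i))

/-- `D` integrates the quadratic Lie algebra `(𝔡, ⟨ , ⟩)`: its Lie algebra is identified with `𝔡`
in such a way that the adjoint action preserves the pairing. -/
structure QuadraticIdent (ED : Type*) [NormedAddCommGroup ED] [NormedSpace ℝ ED]
    (D : Type*) [TopologicalSpace D] [ChartedSpace ED D] [Group D]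
    extends LieAlgebraIdent ED D B.Double where
  pairing_Ad : ∀ (d : D) (a b : B.Double),
    B.pairing (toLieAlgebraIdent.Ad d a) (toLieAlgebraIdent.Ad d b) = B.pairing a b

variable {B}

/-- `π_D = R^r - R^l`. -/
def piD (eD : QuadraticIdent B ED D) {ι : Type*} [Fintype ι] (u : Module.Basis ι ℝ 𝔤) :
    TensorField ED D := fun d =>
  (rmatrix B u).compl₁₂ (rightTriv ED d ∘ₗ eD.equiv.toLinearMap).dualMap
      (rightTriv ED d ∘ₗ eD.equiv.toLinearMap).dualMap -
    (rmatrix B u).compl₁₂ (leftTriv ED d ∘ₗ eD.equiv.toLinearMap).dualMap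
      (leftTriv ED d ∘ₗ eD.equiv.toLinearMap).dualMap

/-- The covector `α` at `g` is `ξ^l|_g` for the element `ξ = leftCoord eG g α` of `𝔤*`. -/
def leftCoord (eG : LieAlgebraIdent EG G 𝔤) (g : G) :
    Module.Dual ℝ (TangentSpace 𝓘(ℝ, EG) g) →ₗ[ℝ] B.DualAlg :=
  B.toDual.symm.toLinearMap ∘ₗ (leftTriv EG g ∘ₗ eG.equiv.toLinearMap).dualMap

/-- The covector `α` at `v` is `u^r|_v` for the element `u = rightCoord eS v α` of `𝔤 = (𝔤*)*`. -/
def rightCoord (eS : LieAlgebraIdent EG G B.DualAlg) (v : G) :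
    Module.Dual ℝ (TangentSpace 𝓘(ℝ, EG) v) →ₗ[ℝ] 𝔤 :=
  B.ofBidual.toLinearMap ∘ₗ (rightTriv EG v ∘ₗ eS.equiv.toLinearMap).dualMap

/-- `π_G|_g(ξ₁^l, ξ₂^l) = ⟨pr_𝔤(Ad_{φ(g)} ξ₁), pr_𝔤*(Ad_{φ(g)} ξ₂)⟩`. -/
def piG (eD : QuadraticIdent B ED D) (eG : LieAlgebraIdent EG G 𝔤) (φ : G →* D) :
    TensorField EG G := fun g =>
  B.pairing.compl₁₂
    (B.inl ∘ₗ B.prg ∘ₗ eD.Ad (φ g) ∘ₗ B.inr ∘ₗ leftCoord eG g)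
    (B.inr ∘ₗ B.prgs ∘ₗ eD.Ad (φ g) ∘ₗ B.inr ∘ₗ leftCoord eG g)

/-- `π_G*|_v(u₁^r, u₂^r) = ⟨pr_𝔤(Ad_{φ(v)⁻¹} u₁), pr_𝔤*(Ad_{φ(v)⁻¹} u₂)⟩`. -/
def piGs (eD : QuadraticIdent B ED D) (eS : LieAlgebraIdent EG G B.DualAlg) (φ : G →* D) :
    TensorField EG G := fun v =>
  B.pairing.compl₁₂
    (B.inl ∘ₗ B.prg ∘ₗ eD.Ad (φ v)⁻¹ ∘ₗ B.inl ∘ₗ rightCoord eS v)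
    (B.inr ∘ₗ B.prgs ∘ₗ eD.Ad (φ v)⁻¹ ∘ₗ B.inl ∘ₗ rightCoord eS v)

end Double

end PoissonLie

end

/-!
Let `p` be the projection of `𝔡` onto `𝔤` along `𝔤*`. On covectors represented through the pairing
by `a, b ∈ 𝔡`, both `π_G` and `π_D` take, at a point with image `d ∈ D`, the value
`⟨(p - Ad_d p Ad_d⁻¹) a, b⟩`, and `π_{G*}` and `-π_D` take the value given by the same formula with
`1 - p` in place of `p`.
The three claims are read off this single formula: it is a cocycle in `d`, which is
multiplicativity; it only involves the image of the point in `D`, so that homomorphisms to `D` are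
Poisson maps; and its derivative at the identity is `-⟨x, [a, b]⟩` when `p a = p b = 0`, which gives
the cobracket.

For the Jacobi identity, represent the differentials of three functions by `𝔡`-valued functions.
The second derivatives cancel up to the bracket of two tangent directions, and what remains is an
algebraic identity for the two Manin projections `p` and `q = Ad_d p Ad_d⁻¹`. It follows from
`⟨p a, [p b, p c]⟩ = 0` and `⟨a - p a, [b - p b, c - p c]⟩ = 0` and their analogues for `q`: the
images and the kernels of both projections are isotropic subalgebras.
-/

noncomputable section

namespace PoissonLie

open VectorField Filter Topology

theorem two_le_infty : (2 : ℕ∞ω) ≤ ∞ := WithTop.coe_le_coe.2 (le_top : (2 : ℕ∞) ≤ ⊤)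

section ModelDerivative

/-- The derivative of a map of manifolds, as a continuous linear map between the model spaces: each
tangent space is identified with the model space by the preferred chart at the base point, so that
derivatives at different points can be compared and differentiated. -/
def modelDeriv (E : Type*) [NormedAddCommGroup E] [NormedSpace ℝ E]
    {M : Type*} [TopologicalSpace M] [ChartedSpace E M]
    (E' : Type*) [NormedAddCommGroup E'] [NormedSpace ℝ E']
    {M' : Type*} [TopologicalSpace M'] [ChartedSpace E' M'] (f : M → M') (x : M) : E →L[ℝ] E' :=
  mfderiv 𝓘(ℝ, E) 𝓘(ℝ, E') f x

variable {E : Type*} [NormedAddCommGroup E] [NormedSpace ℝ E]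
  {M : Type*} [TopologicalSpace M] [ChartedSpace E M]
  {E' : Type*} [NormedAddCommGroup E'] [NormedSpace ℝ E']
  {M' : Type*} [TopologicalSpace M'] [ChartedSpace E' M']
  {E'' : Type*} [NormedAddCommGroup E''] [NormedSpace ℝ E'']
  {N : Type*} [TopologicalSpace N] [ChartedSpace E'' N]
  {F : Type*} [NormedAddCommGroup F] [NormedSpace ℝ F]
  {F₁ : Type*} [NormedAddCommGroup F₁] [NormedSpace ℝ F₁]
  {F₂ : Type*} [NormedAddCommGroup F₂] [NormedSpace ℝ F₂]

theorem modelDeriv_comp {g : M' → N} {f : M → M'} {x : M}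
    (hg : MDifferentiableAt 𝓘(ℝ, E') 𝓘(ℝ, E'') g (f x))
    (hf : MDifferentiableAt 𝓘(ℝ, E) 𝓘(ℝ, E') f x) :
    modelDeriv E E'' (fun y => g (f y)) x =
      (modelDeriv E' E'' g (f x)).comp (modelDeriv E E' f x) :=
  mfderiv_comp x hg hf

theorem modelDeriv_congr {f g : M → M'} {x : M} (h : f =ᶠ[𝓝 x] g) :
    modelDeriv E E' f x = modelDeriv E E' g x :=
  h.mfderiv_eq

theorem modelDeriv_id (x : M) : modelDeriv E E (fun y : M => y) x = ContinuousLinearMap.id ℝ E :=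
  mfderiv_id

theorem modelDeriv_const (c : M') (x : M) : modelDeriv E E' (fun _ : M => c) x = 0 :=
  mfderiv_const

theorem modelDeriv_eq_fderiv (f : E → F) (x : E) : modelDeriv E F f x = fderiv ℝ f x :=
  mfderiv_eq_fderiv

theorem modelDeriv_eq_fderiv_extChartAt {f : M → F} {x : M}
    (hf : MDifferentiableAt 𝓘(ℝ, E) 𝓘(ℝ, F) f x) :
    modelDeriv E F f x =
      fderiv ℝ (fun y => f ((extChartAt 𝓘(ℝ, E) x).symm y)) (extChartAt 𝓘(ℝ, E) x x) := by
  refine (MDifferentiableAt.mfderiv hf).trans ?_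
  rw [← fderivWithin_univ, ← ModelWithCorners.range_eq_univ 𝓘(ℝ, E)]
  rfl

theorem modelDeriv_continuousLinearMap_comp (L : F₁ →L[ℝ] F) {f : M → F₁} {x : M}
    (hf : MDifferentiableAt 𝓘(ℝ, E) 𝓘(ℝ, F₁) f x) :
    modelDeriv E F (fun y => L (f y)) x = L.comp (modelDeriv E F₁ f x) := by
  rw [modelDeriv_comp (g := L) L.differentiableAt.mdifferentiableAt hf, modelDeriv_eq_fderiv,
    ContinuousLinearMap.fderiv]

theorem modelDeriv_bilinear_apply (L : F₁ →L[ℝ] F₂ →L[ℝ] F) {f : M → F₁} {g : M → F₂} {x : M}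
    (hf : MDifferentiableAt 𝓘(ℝ, E) 𝓘(ℝ, F₁) f x) (hg : MDifferentiableAt 𝓘(ℝ, E) 𝓘(ℝ, F₂) g x)
    (w : E) :
    modelDeriv E F (fun y => L (f y) (g y)) x w =
      L (modelDeriv E F₁ f x w) (g x) + L (f x) (modelDeriv E F₂ g x w) := by
  have hL := L.isBoundedBilinearMap.hasFDerivAt (f x, g x)
  rw [modelDeriv_comp (f := fun y => (f y, g y)) (g := fun p : F₁ × F₂ => L p.1 p.2)
    hL.differentiableAt.mdifferentiableAt (hf.prodMk_space hg), modelDeriv_eq_fderiv, hL.fderiv]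
  have hfg : modelDeriv E (F₁ × F₂) (fun y => (f y, g y)) x =
      (modelDeriv E F₁ f x).prod (modelDeriv E F₂ g x) :=
    HasMFDerivAt.mfderiv ⟨hf.continuousAt.prodMk hg.continuousAt,
      hf.hasMFDerivAt.2.prodMk hg.hasMFDerivAt.2⟩
  rw [hfg]
  exact add_comm _ _

theorem modelDeriv_clm_apply {L : M → F₁ →L[ℝ] F} {v : M → F₁} {x : M}
    (hL : MDifferentiableAt 𝓘(ℝ, E) 𝓘(ℝ, F₁ →L[ℝ] F) L x)
    (hv : MDifferentiableAt 𝓘(ℝ, E) 𝓘(ℝ, F₁) v x) (w : E) :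
    modelDeriv E F (fun y => L y (v y)) x w =
      modelDeriv E (F₁ →L[ℝ] F) L x w (v x) + L x (modelDeriv E F₁ v x w) :=
  modelDeriv_bilinear_apply (ContinuousLinearMap.id ℝ (F₁ →L[ℝ] F)) hL hv w

theorem modelDeriv_clm_apply_const {L : M → F₁ →L[ℝ] F} {x : M}
    (hL : MDifferentiableAt 𝓘(ℝ, E) 𝓘(ℝ, F₁ →L[ℝ] F) L x) (v : F₁) (w : E) :
    modelDeriv E F (fun y => L y v) x w = modelDeriv E (F₁ →L[ℝ] F) L x w v := by
  rw [modelDeriv_clm_apply hL mdifferentiableAt_const, modelDeriv_const,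
    zero_apply, map_zero, add_zero]

theorem modelDeriv_comp_apply_mpullback {f : M' → F} {h : M → M'} {x : M}
    (hf : MDifferentiableAt 𝓘(ℝ, E') 𝓘(ℝ, F) f (h x))
    (hh : MDifferentiableAt 𝓘(ℝ, E) 𝓘(ℝ, E') h x) (hinv : (modelDeriv E E' h x).IsInvertible)
    (U : ∀ y : M', TangentSpace 𝓘(ℝ, E') y) :
    modelDeriv E F (fun y => f (h y)) x (mpullback 𝓘(ℝ, E) 𝓘(ℝ, E') h U x) =
      modelDeriv E' F f (h x) (U (h x)) := by
  rw [modelDeriv_comp hf hh]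
  exact congrArg (modelDeriv E' F f (h x)) (hinv.self_apply_inverse (U (h x)))

end ModelDerivative

section Smooth

variable {E : Type*} [NormedAddCommGroup E] [NormedSpace ℝ E]
  {M : Type*} [TopologicalSpace M] [ChartedSpace E M] [IsManifold 𝓘(ℝ, E) ∞ M]
  {F : Type*} [NormedAddCommGroup F] [NormedSpace ℝ F]

theorem eventually_mdifferentiableAt {f : M → F} {x : M}
    (hf : ContMDiffAt 𝓘(ℝ, E) 𝓘(ℝ, F) ∞ f x) :
    ∀ᶠ y in 𝓝 x, MDifferentiableAt 𝓘(ℝ, E) 𝓘(ℝ, F) f y := by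
  filter_upwards [(contMDiffAt_iff_contMDiffAt_nhds (n := 1) (by simp)).1 (hf.of_le (by simp))]
    with y hy
  exact hy.mdifferentiableAt (by simp)

variable (E) in
omit [IsManifold 𝓘(ℝ, E) ∞ M] in
theorem tendsto_extChartAt_symm (x : M) :
    Tendsto (extChartAt 𝓘(ℝ, E) x).symm (𝓝 (extChartAt 𝓘(ℝ, E) x x)) (𝓝 x) := by
  simpa only [ContinuousAt, extChartAt_to_inv] using continuousAt_extChartAt_symm (I := 𝓘(ℝ, E)) x

variable {E' : Type*} [NormedAddCommGroup E'] [NormedSpace ℝ E']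
  {M' : Type*} [TopologicalSpace M'] [ChartedSpace E' M'] [IsManifold 𝓘(ℝ, E') ∞ M']
  {E'' : Type*} [NormedAddCommGroup E''] [NormedSpace ℝ E'']
  {N : Type*} [TopologicalSpace N] [ChartedSpace E'' N] [IsManifold 𝓘(ℝ, E'') ∞ N]

theorem contMDiffAt_modelDeriv {Φ : N → M → M'} {x₀ : N} {m : M}
    (hΦ : ContMDiffAt (𝓘(ℝ, E'').prod 𝓘(ℝ, E)) 𝓘(ℝ, E') ∞ (Function.uncurry Φ) (x₀, m))
    (hchart : ∀ x, chartAt E' (Φ x m) = chartAt E' (Φ x₀ m)) :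
    ContMDiffAt 𝓘(ℝ, E'') 𝓘(ℝ, E →L[ℝ] E') ∞ (fun x => modelDeriv E E' (Φ x) m) x₀ := by
  have hcoord : ContMDiffAt 𝓘(ℝ, E'') 𝓘(ℝ, E →L[ℝ] E') ∞ (inTangentCoordinates 𝓘(ℝ, E) 𝓘(ℝ, E')
      (fun _ => m) (fun x => Φ x m) (fun x => modelDeriv E E' (Φ x) m) x₀) x₀ :=
    ContMDiffAt.mfderiv (m := ∞) Φ (fun _ => m) hΦ contMDiffAt_const (by simp)
  refine hcoord.congr_of_eventuallyEq (Eventually.of_forall fun x => ?_)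
  change modelDeriv E E' (Φ x) m = _
  have hmem : Φ x m ∈ (chartAt E' (Φ x₀ m)).source := hchart x ▸ mem_chart_source E' (Φ x m)
  have hachart : achart E' (Φ x m) = achart E' (Φ x₀ m) := Subtype.ext (hchart x)
  rw [inTangentCoordinates_eq (x₀ := x₀) (x := x) _ _ _ (mem_chart_source _ _) hmem]
  ext v
  simp only [ContinuousLinearMap.comp_apply]
  rw [(tangentBundleCore 𝓘(ℝ, E) M).coordChange_self _ _ (mem_chart_source _ _), hachart,
    (tangentBundleCore 𝓘(ℝ, E') M').coordChange_self _ _ hmem]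

theorem isInvertible_modelDeriv_extChartAt_symm {x : M} {y : E}
    (hy : y ∈ (extChartAt 𝓘(ℝ, E) x).target) :
    (modelDeriv E E (extChartAt 𝓘(ℝ, E) x).symm y).IsInvertible := by
  have h := isInvertible_mfderivWithin_extChartAt_symm hy
  rwa [ModelWithCorners.range_eq_univ, mfderivWithin_univ] at h

theorem mdifferentiableAt_extChartAt_symm {x : M} {y : E}
    (hy : y ∈ (extChartAt 𝓘(ℝ, E) x).target) :
    MDifferentiableAt 𝓘(ℝ, E) 𝓘(ℝ, E) (extChartAt 𝓘(ℝ, E) x).symm y := by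
  have h := mdifferentiableWithinAt_extChartAt_symm hy
  rwa [ModelWithCorners.range_eq_univ, mdifferentiableWithinAt_univ] at h

theorem modelDeriv_extChartAt_self (x : M) :
    modelDeriv E E (extChartAt 𝓘(ℝ, E) x) x = ContinuousLinearMap.id ℝ E :=
  mfderiv_extChartAt_self

theorem mpullback_extChartAt_symm_self (U : ∀ y : M, TangentSpace 𝓘(ℝ, E) y) (x : M) :
    mpullback 𝓘(ℝ, E) 𝓘(ℝ, E) (extChartAt 𝓘(ℝ, E) x).symm U (extChartAt 𝓘(ℝ, E) x x) = U x := by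
  have h := mfderivWithin_extChartAt_symm_inverse_apply (I := 𝓘(ℝ, E)) (U x)
  rw [ModelWithCorners.range_eq_univ, mfderivWithin_univ] at h
  have hU : U ((extChartAt 𝓘(ℝ, E) x).symm (extChartAt 𝓘(ℝ, E) x x)) = U x := by
    rw [extChartAt_to_inv]
  rw [mpullback_apply, hU]
  exact h

theorem mlieBracket_eq_lieBracket_extChartAt (V W : ∀ y : M, TangentSpace 𝓘(ℝ, E) y) (x : M) :
    mlieBracket 𝓘(ℝ, E) V W x = lieBracket ℝ
      (mpullback 𝓘(ℝ, E) 𝓘(ℝ, E) (extChartAt 𝓘(ℝ, E) x).symm V)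
      (mpullback 𝓘(ℝ, E) 𝓘(ℝ, E) (extChartAt 𝓘(ℝ, E) x).symm W) (extChartAt 𝓘(ℝ, E) x x) := by
  rw [← mlieBracketWithin_univ, mlieBracketWithin_apply]
  simp only [Set.preimage_univ, Set.univ_inter, ModelWithCorners.range_eq_univ,
    mpullbackWithin_univ]
  have hchart : (modelDeriv E E (extChartAt 𝓘(ℝ, E) x) x).inverse =
      ContinuousLinearMap.id ℝ E := by
    rw [modelDeriv_extChartAt_self, ContinuousLinearMap.inverse_id]
  exact (congrArg (fun T : E →L[ℝ] E => T _) hchart).trans (congrFun lieBracketWithin_univ _)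

theorem differentiableAt_mpullback_extChartAt_symm [CompleteSpace E]
    {U : ∀ y : M, TangentSpace 𝓘(ℝ, E) y} {x : M}
    (hU : MDifferentiableAt 𝓘(ℝ, E) 𝓘(ℝ, E).tangent
      (fun y => (U y : TangentBundle 𝓘(ℝ, E) M)) x) :
    DifferentiableAt ℝ (mpullback 𝓘(ℝ, E) 𝓘(ℝ, E) (extChartAt 𝓘(ℝ, E) x).symm U)
      (extChartAt 𝓘(ℝ, E) x x) := by
  have h := MDifferentiableWithinAt.differentiableWithinAt_mpullbackWithin_vectorField
    (mdifferentiableWithinAt_univ.2 hU)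
  rw [Set.preimage_univ, Set.univ_inter, ModelWithCorners.range_eq_univ, mpullbackWithin_univ] at h
  exact differentiableWithinAt_univ.1 h

theorem eventually_fderiv_apply_mpullback_extChartAt_symm {f : M → F} {x : M}
    (hf : ContMDiffAt 𝓘(ℝ, E) 𝓘(ℝ, F) ∞ f x) (U : ∀ y : M, TangentSpace 𝓘(ℝ, E) y) :
    (fun y => fderiv ℝ (fun z => f ((extChartAt 𝓘(ℝ, E) x).symm z)) y
        (mpullback 𝓘(ℝ, E) 𝓘(ℝ, E) (extChartAt 𝓘(ℝ, E) x).symm U y)) =ᶠ[𝓝 (extChartAt 𝓘(ℝ, E) x x)]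
      fun y => modelDeriv E F f ((extChartAt 𝓘(ℝ, E) x).symm y)
        (U ((extChartAt 𝓘(ℝ, E) x).symm y)) := by
  filter_upwards [(tendsto_extChartAt_symm E x).eventually (eventually_mdifferentiableAt hf),
    extChartAt_target_mem_nhds (I := 𝓘(ℝ, E)) x] with y hfy hy
  rw [← modelDeriv_eq_fderiv]
  exact modelDeriv_comp_apply_mpullback hfy (mdifferentiableAt_extChartAt_symm hy)
    (isInvertible_modelDeriv_extChartAt_symm hy) U

theorem modelDeriv_apply_mlieBracket [CompleteSpace E] {V W : ∀ y : M, TangentSpace 𝓘(ℝ, E) y}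
    {f : M → F} {x : M} (hf : ContMDiffAt 𝓘(ℝ, E) 𝓘(ℝ, F) ∞ f x)
    (hV : MDifferentiableAt 𝓘(ℝ, E) 𝓘(ℝ, E).tangent (fun y => (V y : TangentBundle 𝓘(ℝ, E) M)) x)
    (hW : MDifferentiableAt 𝓘(ℝ, E) 𝓘(ℝ, E).tangent (fun y => (W y : TangentBundle 𝓘(ℝ, E) M)) x)
    (hVf : MDifferentiableAt 𝓘(ℝ, E) 𝓘(ℝ, F) (fun y => modelDeriv E F f y (V y)) x)
    (hWf : MDifferentiableAt 𝓘(ℝ, E) 𝓘(ℝ, F) (fun y => modelDeriv E F f y (W y)) x) :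
    modelDeriv E F f x (mlieBracket 𝓘(ℝ, E) V W x) =
      modelDeriv E F (fun y => modelDeriv E F f y (W y)) x (V x) -
      modelDeriv E F (fun y => modelDeriv E F f y (V y)) x (W x) := by
  have hfc : ContDiffAt ℝ ∞ (fun y => f ((extChartAt 𝓘(ℝ, E) x).symm y))
      (extChartAt 𝓘(ℝ, E) x x) := by
    have h := (contMDiffAt_iff.1 hf).2
    rwa [ModelWithCorners.range_eq_univ, contDiffWithinAt_univ] at h
  rw [modelDeriv_eq_fderiv_extChartAt (hf.mdifferentiableAt (by simp)),
    modelDeriv_eq_fderiv_extChartAt hVf, modelDeriv_eq_fderiv_extChartAt hWf,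
    ← (eventually_fderiv_apply_mpullback_extChartAt_symm hf V).fderiv_eq,
    ← (eventually_fderiv_apply_mpullback_extChartAt_symm hf W).fderiv_eq,
    mlieBracket_eq_lieBracket_extChartAt, fderiv_apply_lieBracket hfc (by simpa using two_le_infty)
      (differentiableAt_mpullback_extChartAt_symm hW)
      (differentiableAt_mpullback_extChartAt_symm hV),
    mpullback_extChartAt_symm_self, mpullback_extChartAt_symm_self]

theorem contMDiffAt_extChartAt_symm_self (x : M) :
    ContMDiffAt 𝓘(ℝ, E) 𝓘(ℝ, E) ∞ (extChartAt 𝓘(ℝ, E) x).symm (extChartAt 𝓘(ℝ, E) x x) :=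
  (contMDiffOn_extChartAt_symm x).contMDiffAt (extChartAt_target_mem_nhds x)

end Smooth

section MixedPartials

variable {E : Type*} [NormedAddCommGroup E] [NormedSpace ℝ E]
  {E' : Type*} [NormedAddCommGroup E'] [NormedSpace ℝ E']
  {F : Type*} [NormedAddCommGroup F] [NormedSpace ℝ F]

theorem fderiv_fderiv_comp_apply {f : E' → F} {γ : E → E'} {γ' : E →L[ℝ] E'} {x : E}
    (hf : DifferentiableAt ℝ (fderiv ℝ f) (γ x)) (hγ : HasFDerivAt γ γ' x) (v : E) (w : E') :
    fderiv ℝ (fun y => fderiv ℝ f (γ y) w) x v = fderiv ℝ (fderiv ℝ f) (γ x) (γ' v) w := by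
  have h := (hf.hasFDerivAt.comp x hγ).clm_apply (hasFDerivAt_const w x)
  simpa using congrArg (fun T : E →L[ℝ] F => T v) h.fderiv

theorem fderiv_fderiv_prod_comm {Ψ : E × E' → F} {c : E} {c' : E'} (hΨ : ContDiffAt ℝ 2 Ψ (c, c'))
    (v : E) (w : E') :
    fderiv ℝ (fun s => fderiv ℝ (fun t => Ψ (s, t)) c' w) c v =
      fderiv ℝ (fun t => fderiv ℝ (fun s => Ψ (s, t)) c v) c' w := by
  have hd : ∀ᶠ p in 𝓝 (c, c'), DifferentiableAt ℝ Ψ p := by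
    filter_upwards [hΨ.eventually (by simp)] with p hp
    exact hp.differentiableAt (by simp)
  have hdd : DifferentiableAt ℝ (fderiv ℝ Ψ) (c, c') :=
    (hΨ.fderiv_right (m := 1) (by norm_num)).differentiableAt (by simp)
  have hsnd : (fun s => fderiv ℝ (fun t => Ψ (s, t)) c' w) =ᶠ[𝓝 c]
      fun s => fderiv ℝ Ψ (s, c') (0, w) := by
    filter_upwards [((Continuous.prodMk_left c').tendsto c).eventually hd] with s hs
    exact congrArg (fun T : E' →L[ℝ] F => T w)
      (hs.hasFDerivAt.comp c' (hasFDerivAt_prodMk_right s c')).fderiv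
  have hfst : (fun t => fderiv ℝ (fun s => Ψ (s, t)) c v) =ᶠ[𝓝 c']
      fun t => fderiv ℝ Ψ (c, t) (v, 0) := by
    filter_upwards [((Continuous.prodMk_right c).tendsto c').eventually hd] with t ht
    exact congrArg (fun T : E →L[ℝ] F => T v)
      (HasFDerivAt.comp (f := fun s : E => (s, t)) c ht.hasFDerivAt
        (hasFDerivAt_prodMk_left c t)).fderiv
  rw [hsnd.fderiv_eq, hfst.fderiv_eq,
    fderiv_fderiv_comp_apply (γ := fun s => (s, c')) hdd (hasFDerivAt_prodMk_left c c'),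
    fderiv_fderiv_comp_apply (γ := fun t => (c, t)) hdd (hasFDerivAt_prodMk_right c c')]
  exact (hΨ.isSymmSndFDerivAt (by simp)) _ _

variable {M : Type*} [TopologicalSpace M] [ChartedSpace E M] [IsManifold 𝓘(ℝ, E) ∞ M]
  {M' : Type*} [TopologicalSpace M'] [ChartedSpace E' M'] [IsManifold 𝓘(ℝ, E') ∞ M']

omit [IsManifold 𝓘(ℝ, E) ∞ M] [IsManifold 𝓘(ℝ, E') ∞ M'] in
theorem contMDiffAt_uncurry_flip {Φ : M → M' → F} {m : M} {m' : M'}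
    (hΦ : ContMDiffAt (𝓘(ℝ, E).prod 𝓘(ℝ, E')) 𝓘(ℝ, F) ∞ (Function.uncurry Φ) (m, m')) :
    ContMDiffAt (𝓘(ℝ, E').prod 𝓘(ℝ, E)) 𝓘(ℝ, F) ∞ (Function.uncurry (flip Φ)) (m', m) :=
  ContMDiffAt.comp (m', m) (g := Function.uncurry Φ) (f := Prod.swap) hΦ
    (contMDiffAt_snd.prodMk contMDiffAt_fst)

theorem contDiffAt_comp_extChartAt_symm {Φ : M → M' → F} {m : M} {m' : M'}
    (hΦ : ContMDiffAt (𝓘(ℝ, E).prod 𝓘(ℝ, E')) 𝓘(ℝ, F) ∞ (Function.uncurry Φ) (m, m')) :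
    ContDiffAt ℝ ∞ (fun p : E × E' =>
        Φ ((extChartAt 𝓘(ℝ, E) m).symm p.1) ((extChartAt 𝓘(ℝ, E') m').symm p.2))
      (extChartAt 𝓘(ℝ, E) m m, extChartAt 𝓘(ℝ, E') m' m') := by
  rw [← contMDiffAt_iff_contDiffAt]
  refine ContMDiffAt.comp (I' := 𝓘(ℝ, E).prod 𝓘(ℝ, E')) (g := Function.uncurry Φ)
    (f := fun p : E × E' =>
      ((extChartAt 𝓘(ℝ, E) m).symm p.1, (extChartAt 𝓘(ℝ, E') m').symm p.2)) _
    (by simpa only [extChartAt_to_inv] using hΦ) (ContMDiffAt.prodMk ?_ ?_)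
  · exact ContMDiffAt.comp _ (contMDiffAt_extChartAt_symm_self m)
      contDiff_fst.contMDiff.contMDiffAt
  · exact ContMDiffAt.comp _ (contMDiffAt_extChartAt_symm_self m')
      contDiff_snd.contMDiff.contMDiffAt

theorem modelDeriv_modelDeriv_eq_fderiv_fderiv {Φ : M → M' → F} {m : M} {m' : M'}
    (hΦ : ContMDiffAt (𝓘(ℝ, E).prod 𝓘(ℝ, E')) 𝓘(ℝ, F) ∞ (Function.uncurry Φ) (m, m'))
    (v : E) (w : E') :
    modelDeriv E F (fun y => modelDeriv E' F (Φ y) m' w) m v =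
      fderiv ℝ (fun s => fderiv ℝ (fun t => Φ ((extChartAt 𝓘(ℝ, E) m).symm s)
        ((extChartAt 𝓘(ℝ, E') m').symm t)) (extChartAt 𝓘(ℝ, E') m' m') w)
        (extChartAt 𝓘(ℝ, E) m m) v := by
  have hdiff : MDifferentiableAt 𝓘(ℝ, E) 𝓘(ℝ, F) (fun y => modelDeriv E' F (Φ y) m' w) m :=
    ((contMDiffAt_modelDeriv hΦ fun _ => rfl).clm_apply
      contMDiffAt_const).mdifferentiableAt (by simp)
  have hnhds : ∀ᶠ y in 𝓝 m, MDifferentiableAt 𝓘(ℝ, E') 𝓘(ℝ, F) (Φ y) m' := by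
    have h := (contMDiffAt_iff_contMDiffAt_nhds (n := 1) (by simp)).1 (hΦ.of_le (by simp))
    filter_upwards [((Continuous.prodMk_left m').tendsto m).eventually h] with y hy
    exact (hy.mdifferentiableAt (by simp)).comp m'
      (mdifferentiableAt_const.prodMk mdifferentiableAt_id)
  rw [modelDeriv_eq_fderiv_extChartAt hdiff]
  refine congrArg (fun T : E →L[ℝ] F => T v) (Filter.EventuallyEq.fderiv_eq ?_)
  filter_upwards [(tendsto_extChartAt_symm E m).eventually hnhds] with s hs
  rw [modelDeriv_eq_fderiv_extChartAt hs]

theorem modelDeriv_modelDeriv_comm {Φ : M → M' → F} {m : M} {m' : M'}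
    (hΦ : ContMDiffAt (𝓘(ℝ, E).prod 𝓘(ℝ, E')) 𝓘(ℝ, F) ∞ (Function.uncurry Φ) (m, m'))
    (v : E) (w : E') :
    modelDeriv E F (fun y => modelDeriv E' F (Φ y) m' w) m v =
      modelDeriv E' F (fun z => modelDeriv E F (fun y => Φ y z) m v) m' w :=
  calc _ = _ := modelDeriv_modelDeriv_eq_fderiv_fderiv hΦ v w
    _ = _ := fderiv_fderiv_prod_comm ((contDiffAt_comp_extChartAt_symm hΦ).of_le two_le_infty) v w
    _ = _ := (modelDeriv_modelDeriv_eq_fderiv_fderiv (contMDiffAt_uncurry_flip hΦ) w v).symm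

end MixedPartials

section LieGroup

variable {E : Type*} [NormedAddCommGroup E] [NormedSpace ℝ E]
  {G : Type*} [TopologicalSpace G] [ChartedSpace E G] [Group G] [LieGroup 𝓘(ℝ, E) ∞ G]
  {F : Type*} [NormedAddCommGroup F] [NormedSpace ℝ F]

theorem mdifferentiableAt_mul_right (g y : G) :
    MDifferentiableAt 𝓘(ℝ, E) 𝓘(ℝ, E) (fun y : G => y * g) y :=
  (contMDiff_mul_right (I := 𝓘(ℝ, E)) (n := ∞)).mdifferentiableAt (by simp)

theorem mdifferentiableAt_mul_left (g y : G) :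
    MDifferentiableAt 𝓘(ℝ, E) 𝓘(ℝ, E) (fun y : G => g * y) y :=
  (contMDiff_mul_left (I := 𝓘(ℝ, E)) (n := ∞)).mdifferentiableAt (by simp)

theorem mdifferentiableAt_conj (g y : G) :
    MDifferentiableAt 𝓘(ℝ, E) 𝓘(ℝ, E) (fun y : G => g * y * g⁻¹) y :=
  (mdifferentiableAt_mul_right g⁻¹ (g * y)).comp y (mdifferentiableAt_mul_left g y)

theorem mdifferentiableAt_inv (y : G) :
    MDifferentiableAt 𝓘(ℝ, E) 𝓘(ℝ, E) (fun y : G => y⁻¹) y :=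
  (contMDiff_inv 𝓘(ℝ, E) ∞).mdifferentiableAt (by simp)

variable (E) in
/-- The differential at the identity of right translation by `g`, on the model space. -/
def rightTransDeriv (g : G) : E →L[ℝ] E := modelDeriv E E (fun y : G => y * g) 1

variable (E) in
/-- The differential at the identity of left translation by `g`, on the model space. -/
def leftTransDeriv (g : G) : E →L[ℝ] E := modelDeriv E E (fun y : G => g * y) 1

variable (E) in
/-- The adjoint action of `g`, on the model space. -/
def modelAd (g : G) : E →L[ℝ] E := modelDeriv E E (fun y : G => g * y * g⁻¹) 1

omit [LieGroup 𝓘(ℝ, E) ∞ G] in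
theorem rightTransDeriv_one : rightTransDeriv E (1 : G) = ContinuousLinearMap.id ℝ E := by
  simp only [rightTransDeriv, mul_one]
  exact modelDeriv_id _

omit [LieGroup 𝓘(ℝ, E) ∞ G] in
theorem modelAd_one : modelAd E (1 : G) = ContinuousLinearMap.id ℝ E := by
  simp only [modelAd, one_mul, inv_one, mul_one]
  exact modelDeriv_id _

theorem modelAd_mul (g h : G) : modelAd E (g * h) = (modelAd E g).comp (modelAd E h) := by
  have hcomp := modelDeriv_comp (g := fun y : G => g * y * g⁻¹) (f := fun y : G => h * y * h⁻¹)
    (x := 1) (mdifferentiableAt_conj (E := E) g _) (mdifferentiableAt_conj (E := E) h _)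
  simp only [mul_one, mul_inv_cancel] at hcomp
  rw [modelAd, modelAd, modelAd, ← hcomp]
  congr 1
  ext y
  group

theorem rightTransDeriv_eq_leftTransDeriv_comp (g : G) :
    rightTransDeriv E g = (leftTransDeriv E g).comp (modelAd E g⁻¹) := by
  have hcomp := modelDeriv_comp (g := fun y : G => g * y) (f := fun y : G => g⁻¹ * y * g⁻¹⁻¹)
    (x := 1) (mdifferentiableAt_mul_left (E := E) g _) (mdifferentiableAt_conj (E := E) g⁻¹ _)
  simp only [mul_one, mul_inv_cancel] at hcomp
  rw [leftTransDeriv, modelAd, rightTransDeriv, ← hcomp]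
  congr 1
  ext y
  group

theorem contMDiff_modelAd : ContMDiff 𝓘(ℝ, E) 𝓘(ℝ, E →L[ℝ] E) ∞ (modelAd E : G → E →L[ℝ] E) :=
  fun _ => contMDiffAt_modelDeriv (Φ := fun g y : G => g * y * g⁻¹) (m := 1)
    ((contMDiff_fst.mul contMDiff_snd).mul contMDiff_fst.inv).contMDiffAt (by simp)

theorem contMDiff_modelAd_inv :
    ContMDiff 𝓘(ℝ, E) 𝓘(ℝ, E →L[ℝ] E) ∞ (fun y : G => modelAd E y⁻¹) :=
  contMDiff_modelAd.comp (contMDiff_inv 𝓘(ℝ, E) ∞)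

theorem rightTransDeriv_eq_modelDeriv_inv_mulInvariantVectorField (u : E) (g : G) :
    rightTransDeriv E g u = modelDeriv E E (fun y : G => y⁻¹) g⁻¹
      (mulInvariantVectorField (I := 𝓘(ℝ, E)) (modelDeriv E E (fun y : G => y⁻¹) 1 u) g⁻¹) := by
  have hleft := modelDeriv_comp (g := fun y : G => g⁻¹ * y) (f := fun y : G => y⁻¹) (x := 1)
    (mdifferentiableAt_mul_left (E := E) _ _) (mdifferentiableAt_inv _)
  have hinv := modelDeriv_comp (g := fun y : G => y⁻¹) (f := fun y : G => g⁻¹ * y⁻¹) (x := 1)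
    (mdifferentiableAt_inv (E := E) _)
    ((mdifferentiableAt_mul_left (E := E) _ _).comp (1 : G) (mdifferentiableAt_inv _))
  simp only [inv_one, mul_one, mul_inv_rev, inv_inv] at hleft hinv
  rw [rightTransDeriv, hinv, hleft]
  rfl

theorem mdifferentiable_rightInvariantVectorField (u : E) :
    MDifferentiable 𝓘(ℝ, E) 𝓘(ℝ, E).tangent (fun g : G =>
      (rightInvariantVectorField (E := E) (G := G) u g : TangentBundle 𝓘(ℝ, E) G)) := by
  have : LieGroup 𝓘(ℝ, E) (minSmoothness ℝ 3) G :=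
    .of_le (n := ∞) (by simpa using WithTop.coe_le_coe.2 (le_top : (3 : ℕ∞) ≤ ⊤))
  have hleft : MDifferentiable 𝓘(ℝ, E) 𝓘(ℝ, E).tangent (fun g : G =>
      (mulInvariantVectorField (I := 𝓘(ℝ, E)) (modelDeriv E E (fun y : G => y⁻¹) 1 u) g :
        TangentBundle 𝓘(ℝ, E) G)) := fun g => mdifferentiableAt_mulInvariantVectorField _
  have htangent : MDifferentiable 𝓘(ℝ, E).tangent 𝓘(ℝ, E).tangent
      (tangentMap 𝓘(ℝ, E) 𝓘(ℝ, E) (fun y : G => y⁻¹)) :=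
    ((contMDiff_inv 𝓘(ℝ, E) ∞).contMDiff_tangentMap (m := ∞) (by simp)).mdifferentiable (by simp)
  have heq : (fun g : G =>
      (rightInvariantVectorField (E := E) (G := G) u g : TangentBundle 𝓘(ℝ, E) G)) =
      fun g => tangentMap 𝓘(ℝ, E) 𝓘(ℝ, E) (fun y : G => y⁻¹) (mulInvariantVectorField
        (I := 𝓘(ℝ, E)) (modelDeriv E E (fun y : G => y⁻¹) 1 u) g⁻¹ : TangentBundle 𝓘(ℝ, E) G) :=
    funext fun g => Bundle.TotalSpace.ext (inv_inv g).symm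
      (heq_of_eq (rightTransDeriv_eq_modelDeriv_inv_mulInvariantVectorField u g))
  rw [heq]
  exact (htangent.comp hleft).comp fun g => mdifferentiableAt_inv g

variable (E) in
/-- The derivative of `f` along right invariant vector fields: `rightDeriv E f g u` is the
derivative of `f` at `g` along the right invariant vector field with value `u` at the identity. -/
def rightDeriv (f : G → F) (g : G) : E →L[ℝ] F := (modelDeriv E F f g).comp (rightTransDeriv E g)

omit [LieGroup 𝓘(ℝ, E) ∞ G] in
theorem rightDeriv_one (f : G → F) : rightDeriv E f 1 = modelDeriv E F f 1 := by
  rw [rightDeriv, rightTransDeriv_one, ContinuousLinearMap.comp_id]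

theorem rightDeriv_eq_modelDeriv {f : G → F} {g : G}
    (hf : MDifferentiableAt 𝓘(ℝ, E) 𝓘(ℝ, F) f g) :
    rightDeriv E f g = modelDeriv E F (fun z => f (z * g)) 1 := by
  rw [modelDeriv_comp (g := f) (f := fun z : G => z * g) (by simpa only [one_mul] using hf)
    (mdifferentiableAt_mul_right (E := E) g _), rightDeriv, rightTransDeriv, one_mul]

theorem rightDeriv_comp_mul_right {f : G → F} {g h : G}
    (hf : MDifferentiableAt 𝓘(ℝ, E) 𝓘(ℝ, F) f (h * g)) :
    rightDeriv E (fun z => f (z * g)) h = rightDeriv E f (h * g) := by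
  have hfg : MDifferentiableAt 𝓘(ℝ, E) 𝓘(ℝ, F) (fun z => f (z * g)) h :=
    MDifferentiableAt.comp (g := f) h hf (mdifferentiableAt_mul_right g h)
  rw [rightDeriv_eq_modelDeriv hf, rightDeriv_eq_modelDeriv hfg]
  simp only [mul_assoc]

theorem contMDiffAt_rightDeriv {f : G → F} {g : G} (hf : ContMDiffAt 𝓘(ℝ, E) 𝓘(ℝ, F) ∞ f g) :
    ContMDiffAt 𝓘(ℝ, E) 𝓘(ℝ, E →L[ℝ] F) ∞ (rightDeriv E f) g := by
  have htrans : ContMDiffAt 𝓘(ℝ, E) 𝓘(ℝ, E →L[ℝ] F) ∞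
      (fun y => modelDeriv E F (fun z => f (z * y)) 1) g :=
    contMDiffAt_modelDeriv (Φ := fun y z : G => f (z * y))
      (ContMDiffAt.comp (g := f) (f := fun p : G × G => p.2 * p.1) (g, 1) (by simpa using hf)
        (contMDiff_snd.mul contMDiff_fst).contMDiffAt) fun _ => rfl
  refine htrans.congr_of_eventuallyEq ?_
  filter_upwards [eventually_mdifferentiableAt hf] with y hy using rightDeriv_eq_modelDeriv hy

theorem contMDiffAt_rightDeriv_apply {f : G → F} {g : G}
    (hf : ContMDiffAt 𝓘(ℝ, E) 𝓘(ℝ, F) ∞ f g) (u : E) :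
    ContMDiffAt 𝓘(ℝ, E) 𝓘(ℝ, F) ∞ (fun y => rightDeriv E f y u) g :=
  (contMDiffAt_rightDeriv hf).clm_apply contMDiffAt_const

variable (E G) in
/-- The bracket of the Lie algebra of `G` on the model space, formed with right invariant vector
fields. -/
def modelBracket (x y : E) : E :=
  mlieBracket 𝓘(ℝ, E) (rightInvariantVectorField (E := E) (G := G) x)
    (rightInvariantVectorField (E := E) (G := G) y) (1 : G)

theorem modelDeriv_modelBracket [CompleteSpace E] {f : G → F}
    (hf : ContMDiffAt 𝓘(ℝ, E) 𝓘(ℝ, F) ∞ f 1) (x y : E) :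
    modelDeriv E F f 1 (modelBracket E G x y) =
      modelDeriv E F (fun z => rightDeriv E f z y) 1 x -
        modelDeriv E F (fun z => rightDeriv E f z x) 1 y := by
  have h := modelDeriv_apply_mlieBracket
    (V := rightInvariantVectorField (E := E) (G := G) x)
    (W := rightInvariantVectorField (E := E) (G := G) y) hf
    (mdifferentiable_rightInvariantVectorField x 1) (mdifferentiable_rightInvariantVectorField y 1)
    ((contMDiffAt_rightDeriv_apply hf x).mdifferentiableAt (by simp))
    ((contMDiffAt_rightDeriv_apply hf y).mdifferentiableAt (by simp))
  have hone (u : E) : rightInvariantVectorField (E := E) (G := G) u 1 = u :=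
    congrArg (fun T : E →L[ℝ] E => T u) (rightTransDeriv_one (E := E) (G := G))
  rw [hone, hone] at h
  exact h

theorem rightDeriv_modelBracket [CompleteSpace E] {f : G → F} {g : G}
    (hf : ContMDiffAt 𝓘(ℝ, E) 𝓘(ℝ, F) ∞ f g) (x y : E) :
    rightDeriv E f g (modelBracket E G x y) =
      rightDeriv E (fun z => rightDeriv E f z y) g x -
        rightDeriv E (fun z => rightDeriv E f z x) g y := by
  have htrans : Tendsto (fun z : G => z * g) (𝓝 1) (𝓝 g) := by
    simpa only [one_mul] using
      (contMDiff_mul_right (I := 𝓘(ℝ, E)) (n := ∞) (a := g)).continuous.tendsto (1 : G)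
  have hderiv (u : E) : (fun z => rightDeriv E (fun z => f (z * g)) z u) =ᶠ[𝓝 1]
      fun z => rightDeriv E f (z * g) u := by
    filter_upwards [htrans.eventually (eventually_mdifferentiableAt hf)] with z hz
    rw [rightDeriv_comp_mul_right hz]
  have hfg : ContMDiffAt 𝓘(ℝ, E) 𝓘(ℝ, F) ∞ (fun z => f (z * g)) 1 :=
    ContMDiffAt.comp (g := f) 1 (by simpa only [one_mul] using hf) contMDiff_mul_right.contMDiffAt
  have hmdiff (u : E) := (contMDiffAt_rightDeriv_apply hf u).mdifferentiableAt (by simp)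
  rw [rightDeriv_eq_modelDeriv (hf.mdifferentiableAt (by simp)), modelDeriv_modelBracket hfg,
    modelDeriv_congr (hderiv x), modelDeriv_congr (hderiv y), rightDeriv_eq_modelDeriv (hmdiff x),
    rightDeriv_eq_modelDeriv (hmdiff y)]

theorem rightDeriv_eq_modelDeriv_comp_modelAd_inv {f : G → F} {g : G}
    (hf : MDifferentiableAt 𝓘(ℝ, E) 𝓘(ℝ, F) f g) :
    rightDeriv E f g = (modelDeriv E F (fun z => f (g * z)) 1).comp (modelAd E g⁻¹) := by
  rw [modelDeriv_comp (g := f) (f := fun z : G => g * z) (by simpa only [mul_one] using hf)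
    (mdifferentiableAt_mul_left (E := E) g _), rightDeriv, rightTransDeriv_eq_leftTransDeriv_comp,
    mul_one]
  rfl

theorem modelDeriv_modelAd_inv_one [CompleteSpace E] (x a : E) :
    modelDeriv E E (fun y : G => modelAd E y⁻¹ a) 1 x = modelBracket E G x a := by
  obtain ⟨f, hf, hfd⟩ : ∃ f : G → E, ContMDiffAt 𝓘(ℝ, E) 𝓘(ℝ, E) ∞ f 1 ∧
      modelDeriv E E f 1 = ContinuousLinearMap.id ℝ E :=
    ⟨extChartAt 𝓘(ℝ, E) (1 : G), contMDiffAt_extChartAt, modelDeriv_extChartAt_self 1⟩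
  have hΦ : ContMDiffAt (𝓘(ℝ, E).prod 𝓘(ℝ, E)) 𝓘(ℝ, E) ∞
      (Function.uncurry fun y z : G => f (y * z)) (1, 1) :=
    ContMDiffAt.comp (g := f) (f := fun p : G × G => p.1 * p.2) (1, 1)
      (by simpa only [mul_one] using hf) (contMDiff_fst.mul contMDiff_snd).contMDiffAt
  have hΦ' := (contMDiffAt_modelDeriv hΦ fun _ => rfl).mdifferentiableAt (by simp)
  have hAd : MDifferentiableAt 𝓘(ℝ, E) 𝓘(ℝ, E) (fun y : G => modelAd E y⁻¹ a) 1 :=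
    ((contMDiff_modelAd_inv.clm_apply contMDiff_const).mdifferentiable (by simp)) 1
  have hleft : (fun y => rightDeriv E f y a) =ᶠ[𝓝 1]
      fun y => modelDeriv E E (fun z => f (y * z)) 1 (modelAd E y⁻¹ a) := by
    filter_upwards [eventually_mdifferentiableAt hf] with y hy
    rw [rightDeriv_eq_modelDeriv_comp_modelAd_inv hy, ContinuousLinearMap.comp_apply]
  have hright : (fun z => rightDeriv E f z x) =ᶠ[𝓝 1]
      fun z => modelDeriv E E (fun y => f (y * z)) 1 x := by
    filter_upwards [eventually_mdifferentiableAt hf] with z hz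
    rw [rightDeriv_eq_modelDeriv hz]
  have h := modelDeriv_modelBracket hf x a
  rw [modelDeriv_congr hleft, modelDeriv_congr hright, modelDeriv_clm_apply hΦ' hAd,
    ← modelDeriv_modelDeriv_comm hΦ x a, modelDeriv_clm_apply_const hΦ'] at h
  simpa only [inv_one, modelAd_one, one_mul, hfd, ContinuousLinearMap.id_apply,
    add_sub_cancel_left] using h.symm

theorem rightDeriv_modelAd_inv [CompleteSpace E] (g : G) (x a : E) :
    rightDeriv E (fun y : G => modelAd E y⁻¹ a) g x = modelAd E g⁻¹ (modelBracket E G x a) := by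
  have hAd : MDifferentiable 𝓘(ℝ, E) 𝓘(ℝ, E) (fun y : G => modelAd E y⁻¹ a) :=
    (contMDiff_modelAd_inv.clm_apply contMDiff_const).mdifferentiable (by simp)
  have htrans : (fun z : G => modelAd E (z * g)⁻¹ a) =
      fun z => modelAd E g⁻¹ (modelAd E z⁻¹ a) := by
    ext z
    rw [mul_inv_rev, modelAd_mul, ContinuousLinearMap.comp_apply]
  rw [rightDeriv_eq_modelDeriv (hAd g), htrans,
    modelDeriv_continuousLinearMap_comp (modelAd E g⁻¹) (hAd 1), ContinuousLinearMap.comp_apply,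
    modelDeriv_modelAd_inv_one]

theorem modelAd_modelBracket [CompleteSpace E] (g : G) (x a : E) :
    modelAd E g (modelBracket E G x a) = modelBracket E G (modelAd E g x) (modelAd E g a) := by
  have hAd (b : E) : MDifferentiable 𝓘(ℝ, E) 𝓘(ℝ, E) (fun y : G => modelAd E y⁻¹ b) :=
    (contMDiff_modelAd_inv.clm_apply contMDiff_const).mdifferentiable (by simp)
  have hconj : (fun z : G => modelAd E g (modelAd E z⁻¹ a)) =
      fun z => modelAd E (g * z * g⁻¹)⁻¹ (modelAd E g a) := by
    ext z
    rw [← ContinuousLinearMap.comp_apply, ← ContinuousLinearMap.comp_apply, ← modelAd_mul,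
      ← modelAd_mul]
    congr 2
    group
  have hone : g * 1 * g⁻¹ = 1 := by simp
  have hcomp := modelDeriv_comp (g := fun y : G => modelAd E y⁻¹ (modelAd E g a))
    (f := fun z : G => g * z * g⁻¹) (x := 1) (hAd _ _) (mdifferentiableAt_conj g 1)
  rw [← hconj, modelDeriv_continuousLinearMap_comp (modelAd E g) (hAd a 1), hone, ← modelAd]
    at hcomp
  simpa only [ContinuousLinearMap.comp_apply, modelDeriv_modelAd_inv_one] using
    congrArg (fun T : E →L[ℝ] E => T x) hcomp

end LieGroup

section ManinProjection

variable {𝔡 : Type*} [LieRing 𝔡] [LieAlgebra ℝ 𝔡] {κ : LinearMap.BilinForm ℝ 𝔡} {p q : 𝔡 →ₗ[ℝ] 𝔡}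

/-- A Manin triple structure on a Lie algebra `𝔡` with invariant symmetric form `κ`, encoded by the
projection `p` onto one of its two isotropic subalgebras along the other one. If `κ` is
nondegenerate, then `p` is idempotent. -/
structure IsManinProj (κ : LinearMap.BilinForm ℝ 𝔡) (p : 𝔡 →ₗ[ℝ] 𝔡) : Prop where
  symm : ∀ a b, κ a b = κ b a
  invariant : ∀ a b c, κ ⁅a, b⁆ c = κ a ⁅b, c⁆
  isotropic : ∀ a b, κ (p a) (p b) = 0
  isotropic_compl : ∀ a b, κ (a - p a) (b - p b) = 0
  map_lie_map : ∀ a b, p ⁅p a, p b⁆ = ⁅p a, p b⁆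
  map_lie_compl : ∀ a b, p ⁅a - p a, b - p b⁆ = 0

namespace IsManinProj

theorem apply_map_left (hp : IsManinProj κ p) (a b : 𝔡) : κ (p a) b = κ a b - κ a (p b) := by
  have h := hp.isotropic_compl a b
  simp only [map_sub, LinearMap.sub_apply, hp.isotropic] at h
  linarith

theorem compl (hp : IsManinProj κ p) : IsManinProj κ (LinearMap.id - p) where
  symm := hp.symm
  invariant := hp.invariant
  isotropic := hp.isotropic_compl
  isotropic_compl a b := by simpa using hp.isotropic a b
  map_lie_map a b := by simpa using hp.map_lie_compl a b
  map_lie_compl a b := by simpa [sub_eq_zero] using (hp.map_lie_map a b).symm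

theorem conj (hp : IsManinProj κ p) {A A' : 𝔡 →ₗ[ℝ] 𝔡} (hκ : ∀ a b, κ (A a) (A b) = κ a b)
    (hlie : ∀ a b, A ⁅a, b⁆ = ⁅A a, A b⁆) (hleft : ∀ a, A' (A a) = a) (hright : ∀ a, A (A' a) = a) :
    IsManinProj κ (A ∘ₗ p ∘ₗ A') := by
  have hsub (a : 𝔡) : a - A (p (A' a)) = A (A' a - p (A' a)) := by rw [map_sub, hright]
  refine ⟨hp.symm, hp.invariant, fun a b => ?_, fun a b => ?_, fun a b => ?_, fun a b => ?_⟩ <;>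
    simp only [LinearMap.comp_apply, hsub, hκ, ← hlie, hleft, hp.isotropic, hp.isotropic_compl,
      hp.map_lie_map, hp.map_lie_compl, map_zero]

theorem apply_map_lie_map (hp : IsManinProj κ p) (a b c : 𝔡) : κ (p a) ⁅p b, p c⁆ = 0 := by
  rw [← hp.map_lie_map, hp.isotropic]

theorem apply_compl_lie_compl (hp : IsManinProj κ p) (a b c : 𝔡) :
    κ (a - p a) ⁅b - p b, c - p c⁆ = 0 :=
  hp.compl.apply_map_lie_map a b c

theorem apply_lie_rotate (hp : IsManinProj κ p) (a b c : 𝔡) : κ a ⁅b, c⁆ = κ b ⁅c, a⁆ := by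
  rw [hp.symm, hp.invariant]

theorem sub_cyclic_sum_eq_zero (hp : IsManinProj κ p) (hq : IsManinProj κ q) {r : 𝔡 →ₗ[ℝ] 𝔡}
    (hr : r = p - q) (a b c : 𝔡) :
    (κ c ⁅r a, r b⁆ + κ (r a) (⁅q b, c⁆ + ⁅b, q c⁆ - ⁅b, c⁆)) +
      (κ a ⁅r b, r c⁆ + κ (r b) (⁅q c, a⁆ + ⁅c, q a⁆ - ⁅c, a⁆)) +
      (κ b ⁅r c, r a⁆ + κ (r c) (⁅q a, b⁆ + ⁅a, q b⁆ - ⁅a, b⁆)) = 0 := by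
  have hpp := hp.apply_map_lie_map a b c
  have hpc := hp.apply_compl_lie_compl a b c
  have hqq := hq.apply_map_lie_map a b c
  have hqc := hq.apply_compl_lie_compl a b c
  simp only [map_add, map_sub, hr, LinearMap.sub_apply, lie_sub, sub_lie,
    hp.apply_lie_rotate c, hp.apply_lie_rotate (p c), hp.apply_lie_rotate (q c),
    ← hp.apply_lie_rotate _ b, ← hp.apply_lie_rotate _ (p b), ← hp.apply_lie_rotate _ (q b)]
    at hpp hpc hqq hqc ⊢
  linear_combination hpp + hpc - hqq - hqc

end IsManinProj

end ManinProjection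

section LieAlgebraIdent

variable {E : Type*} [NormedAddCommGroup E] [NormedSpace ℝ E]
  {G : Type*} [TopologicalSpace G] [ChartedSpace E G] [Group G]
  {𝔞 : Type*} [LieRing 𝔞] [LieAlgebra ℝ 𝔞] (e : LieAlgebraIdent E G 𝔞)

/-- The identification `e.equiv` of `𝔞` with the Lie algebra of `G`, regarded as a map to the model
space so that it can be composed with the maps of the calculus on the model space. -/
def LieAlgebraIdent.toModel : 𝔞 ≃ₗ[ℝ] E := e.equiv

theorem LieAlgebraIdent.toModel_lie (a b : 𝔞) :
    e.toModel ⁅a, b⁆ = modelBracket E G (e.toModel a) (e.toModel b) := e.map_lie a b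

theorem LieAlgebraIdent.toModel_Ad (g : G) (a : 𝔞) :
    e.toModel (e.Ad g a) = modelAd E g (e.toModel a) := e.toModel.apply_symm_apply _

theorem LieAlgebraIdent.rightTriv_equiv (g : G) (a : 𝔞) :
    rightTriv E g (e.equiv a) = rightTransDeriv E g (e.toModel a) := rfl

theorem LieAlgebraIdent.leftTriv_equiv (g : G) (a : 𝔞) :
    leftTriv E g (e.equiv a) = leftTransDeriv E g (e.toModel a) := rfl

theorem LieAlgebraIdent.Ad_one (a : 𝔞) : e.Ad (1 : G) a = a := by
  apply e.toModel.injective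
  rw [e.toModel_Ad, modelAd_one, ContinuousLinearMap.id_apply]

variable [LieGroup 𝓘(ℝ, E) ∞ G]

theorem LieAlgebraIdent.Ad_mul (g h : G) (a : 𝔞) : e.Ad (g * h) a = e.Ad g (e.Ad h a) := by
  apply e.toModel.injective
  rw [e.toModel_Ad, e.toModel_Ad, e.toModel_Ad, modelAd_mul, ContinuousLinearMap.comp_apply]

theorem LieAlgebraIdent.Ad_Ad_inv (g : G) (a : 𝔞) : e.Ad g (e.Ad g⁻¹ a) = a := by
  rw [← e.Ad_mul, mul_inv_cancel, e.Ad_one]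

theorem LieAlgebraIdent.Ad_inv_Ad (g : G) (a : 𝔞) : e.Ad g⁻¹ (e.Ad g a) = a := by
  rw [← e.Ad_mul, inv_mul_cancel, e.Ad_one]

theorem LieAlgebraIdent.Ad_lie [CompleteSpace E] (g : G) (a b : 𝔞) :
    e.Ad g ⁅a, b⁆ = ⁅e.Ad g a, e.Ad g b⁆ := by
  apply e.toModel.injective
  rw [e.toModel_Ad, e.toModel_lie, modelAd_modelBracket, e.toModel_lie, e.toModel_Ad, e.toModel_Ad]

theorem LieAlgebraIdent.leftTriv_eq_rightTriv_Ad (g : G) (a : 𝔞) :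
    leftTriv E g (e.equiv a) = rightTriv E g (e.equiv (e.Ad g a)) := by
  rw [e.rightTriv_equiv, rightTransDeriv_eq_leftTransDeriv_comp, ContinuousLinearMap.comp_apply,
    ← e.toModel_Ad, e.Ad_inv_Ad, e.leftTriv_equiv]

theorem rightTransDeriv_mul (g h : G) :
    rightTransDeriv E (g * h) =
      (modelDeriv E E (fun y : G => y * h) g).comp (rightTransDeriv E g) := by
  have hcomp := modelDeriv_comp (g := fun y : G => y * h) (f := fun y : G => y * g) (x := 1)
    (mdifferentiableAt_mul_right (E := E) h _) (mdifferentiableAt_mul_right (E := E) g _)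
  simpa only [rightTransDeriv, mul_assoc, one_mul] using hcomp

theorem dRight_rightTriv (g h : G) (u : GroupLieAlgebra 𝓘(ℝ, E) G) :
    dRight E h g (rightTriv E g u) = rightTriv E (g * h) u :=
  (congrArg (fun T : E →L[ℝ] E => T u) (rightTransDeriv_mul g h)).symm

theorem rightTrivInv_rightTriv (g : G) (u : GroupLieAlgebra 𝓘(ℝ, E) G) :
    rightTrivInv E g (rightTriv E g u) = u := by
  have h := congrArg (fun T : E →L[ℝ] E => T u) (rightTransDeriv_mul g g⁻¹)
  rw [mul_inv_cancel, rightTransDeriv_one] at h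
  exact h.symm

theorem modelDeriv_mul_left_comp_rightTransDeriv (g h : G) :
    (modelDeriv E E (fun y : G => g * y) h).comp (rightTransDeriv E h) =
      (rightTransDeriv E (g * h)).comp (modelAd E g) := by
  have hleft := modelDeriv_comp (g := fun y : G => g * y) (f := fun y : G => y * h) (x := 1)
    (mdifferentiableAt_mul_left (E := E) g _) (mdifferentiableAt_mul_right (E := E) h _)
  have hright := modelDeriv_comp (g := fun y : G => y * (g * h)) (f := fun y : G => g * y * g⁻¹)
    (x := 1) (mdifferentiableAt_mul_right (E := E) (g * h) _) (mdifferentiableAt_conj (E := E) g _)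
  have heq : (fun y : G => g * (y * h)) = fun y => g * y * g⁻¹ * (g * h) := by
    ext y
    group
  rw [heq, hright] at hleft
  simpa only [rightTransDeriv, modelAd, mul_one, mul_inv_cancel, one_mul] using hleft.symm

theorem LieAlgebraIdent.dLeft_rightTriv (g h : G) (a : 𝔞) :
    dLeft E g h (rightTriv E h (e.equiv a)) = rightTriv E (g * h) (e.equiv (e.Ad g a)) := by
  rw [e.rightTriv_equiv (g * h), e.toModel_Ad]
  exact congrArg (fun T : E →L[ℝ] E => T (e.toModel a))
    (modelDeriv_mul_left_comp_rightTransDeriv g h)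

end LieAlgebraIdent

section Integration

variable {E : Type*} [NormedAddCommGroup E] [NormedSpace ℝ E]
  {G : Type*} [TopologicalSpace G] [ChartedSpace E G] [Group G]
  {E' : Type*} [NormedAddCommGroup E'] [NormedSpace ℝ E']
  {D : Type*} [TopologicalSpace D] [ChartedSpace E' D] [Group D]
  {𝔞 : Type*} [LieRing 𝔞] [LieAlgebra ℝ 𝔞] {𝔡 : Type*} [LieRing 𝔡] [LieAlgebra ℝ 𝔡]
  {e : LieAlgebraIdent E G 𝔞} {eD : LieAlgebraIdent E' D 𝔡} {ι : 𝔞 →ₗ[ℝ] 𝔡} {ψ : G →* D}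

namespace IsIntegration

protected theorem id (e : LieAlgebraIdent E G 𝔞) :
    IsIntegration e e LinearMap.id (MonoidHom.id G) where
  smooth := contMDiff_id
  deriv a := congrArg (fun T : E →L[ℝ] E => T (e.toModel a)) (modelDeriv_id (E := E) (1 : G))

theorem mdifferentiableAt (h : IsIntegration e eD ι ψ) (g : G) :
    MDifferentiableAt 𝓘(ℝ, E) 𝓘(ℝ, E') ψ g := h.smooth.mdifferentiableAt (by simp)

theorem modelDeriv_one (h : IsIntegration e eD ι ψ) (a : 𝔞) :
    modelDeriv E E' ψ 1 (e.toModel a) = eD.toModel (ι a) := h.deriv a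

variable [LieGroup 𝓘(ℝ, E) ∞ G] [LieGroup 𝓘(ℝ, E') ∞ D]

theorem modelDeriv_rightTransDeriv (h : IsIntegration e eD ι ψ) (g : G) (a : 𝔞) :
    modelDeriv E E' ψ g (rightTransDeriv E g (e.toModel a)) =
      rightTransDeriv E' (ψ g) (eD.toModel (ι a)) := by
  have hleft := modelDeriv_comp (g := ψ) (f := fun y : G => y * g) (x := 1)
    (h.mdifferentiableAt _) (mdifferentiableAt_mul_right (E := E) g _)
  have hright := modelDeriv_comp (g := fun z : D => z * ψ g) (f := ψ) (x := 1)
    (mdifferentiableAt_mul_right (E := E') (ψ g) _) (h.mdifferentiableAt _)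
  simp only [map_mul] at hleft
  rw [hright, one_mul] at hleft
  have happly := congrArg (fun T : E →L[ℝ] E' => T (e.toModel a)) hleft
  simp only [ContinuousLinearMap.comp_apply, map_one, h.modelDeriv_one] at happly
  exact happly.symm

theorem dmap_rightTriv (h : IsIntegration e eD ι ψ) (g : G) (a : 𝔞) :
    dmap E E' ψ g (rightTriv E g (e.equiv a)) = rightTriv E' (ψ g) (eD.equiv (ι a)) :=
  h.modelDeriv_rightTransDeriv g a

theorem map_Ad (h : IsIntegration e eD ι ψ) (g : G) (a : 𝔞) :
    ι (e.Ad g a) = eD.Ad (ψ g) (ι a) := by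
  apply eD.toModel.injective
  rw [← h.modelDeriv_one, eD.toModel_Ad, e.toModel_Ad, ← h.modelDeriv_one]
  have hleft := modelDeriv_comp (g := ψ) (f := fun y : G => g * y * g⁻¹) (x := 1)
    (h.mdifferentiableAt _) (mdifferentiableAt_conj (E := E) g _)
  have hright := modelDeriv_comp (g := fun z : D => ψ g * z * (ψ g)⁻¹) (f := ψ) (x := 1)
    (mdifferentiableAt_conj (E := E') (ψ g) _) (h.mdifferentiableAt _)
  simp only [map_mul, map_inv] at hleft
  rw [hright] at hleft
  have happly := congrArg (fun T : E →L[ℝ] E' => T (e.toModel a)) hleft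
  simp only [ContinuousLinearMap.comp_apply, map_one, mul_one, mul_inv_cancel] at happly
  exact happly.symm

theorem rightDeriv_comp (h : IsIntegration e eD ι ψ) {F : Type*} [NormedAddCommGroup F]
    [NormedSpace ℝ F] {f : D → F} {g : G}
    (hf : MDifferentiableAt 𝓘(ℝ, E') 𝓘(ℝ, F) f (ψ g)) (a : 𝔞) :
    rightDeriv E (fun y => f (ψ y)) g (e.toModel a) =
      rightDeriv E' f (ψ g) (eD.toModel (ι a)) := by
  rw [rightDeriv, modelDeriv_comp hf (h.mdifferentiableAt g), ContinuousLinearMap.comp_apply,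
    ContinuousLinearMap.comp_apply, h.modelDeriv_rightTransDeriv, rightDeriv,
    ContinuousLinearMap.comp_apply]

end IsIntegration

end Integration

section SkewOp

variable {E : Type*} [NormedAddCommGroup E] [NormedSpace ℝ E]
  {D : Type*} [TopologicalSpace D] [ChartedSpace E D] [Group D]
  {𝔡 : Type*} [LieRing 𝔡] [LieAlgebra ℝ 𝔡] (eD : LieAlgebraIdent E D 𝔡) (p : 𝔡 →ₗ[ℝ] 𝔡)

/-- The conjugate `Ad_d p Ad_d⁻¹` of an endomorphism of the Lie algebra of `D`. For a Manin
projection `p` this is again one, with both subalgebras translated by `Ad_d`. -/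
def projAd (d : D) : 𝔡 →ₗ[ℝ] 𝔡 := eD.Ad d ∘ₗ p ∘ₗ eD.Ad d⁻¹

/-- The endomorphism `p - Ad_d p Ad_d⁻¹` of the Lie algebra of `D`. It is the multiplicative
bivector field attached to the Manin projection `p`, right translated to the identity and turned
into an endomorphism by the invariant form. -/
def skewOp (d : D) : 𝔡 →ₗ[ℝ] 𝔡 := p - projAd eD p d

variable {eD p}

theorem projAd_apply (d : D) (a : 𝔡) : projAd eD p d a = eD.Ad d (p (eD.Ad d⁻¹ a)) := rfl

theorem skewOp_apply (d : D) (a : 𝔡) : skewOp eD p d a = p a - projAd eD p d a := rfl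

theorem projAd_one : projAd eD p 1 = p := by
  ext a
  rw [projAd_apply, inv_one, eD.Ad_one, eD.Ad_one]

theorem skewOp_one : skewOp eD p 1 = 0 := by rw [skewOp, projAd_one, sub_self]

variable [LieGroup 𝓘(ℝ, E) ∞ D]

theorem projAd_id_sub (d : D) (a : 𝔡) :
    projAd eD (LinearMap.id - p) d a = a - projAd eD p d a := by
  rw [projAd_apply, projAd_apply, LinearMap.sub_apply, LinearMap.id_apply, map_sub, eD.Ad_Ad_inv]

theorem skewOp_id_sub (d : D) (a : 𝔡) : skewOp eD (LinearMap.id - p) d a = -skewOp eD p d a := by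
  rw [skewOp_apply, skewOp_apply, projAd_id_sub, LinearMap.sub_apply, LinearMap.id_apply]
  abel

theorem skewOp_mul (g h : D) (a : 𝔡) :
    skewOp eD p (g * h) a = skewOp eD p g a + eD.Ad g (skewOp eD p h (eD.Ad g⁻¹ a)) := by
  simp only [skewOp_apply, projAd_apply, map_sub, mul_inv_rev, eD.Ad_mul]
  abel

variable {κ : LinearMap.BilinForm ℝ 𝔡} (hp : IsManinProj κ p)
  (hAd : ∀ (d : D) (a b : 𝔡), κ (eD.Ad d a) (eD.Ad d b) = κ a b)

include hAd in
theorem apply_Ad_left (d : D) (a b : 𝔡) : κ (eD.Ad d a) b = κ a (eD.Ad d⁻¹ b) := by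
  rw [← hAd d⁻¹, eD.Ad_inv_Ad]

include hAd in
theorem apply_Ad_right (d : D) (a b : 𝔡) : κ a (eD.Ad d b) = κ (eD.Ad d⁻¹ a) b := by
  rw [← hAd d⁻¹, eD.Ad_inv_Ad]

include hp hAd

theorem isManinProj_projAd [CompleteSpace E] (d : D) : IsManinProj κ (projAd eD p d) :=
  hp.conj (hAd d) (eD.Ad_lie d) (eD.Ad_inv_Ad d) (eD.Ad_Ad_inv d)

theorem apply_skewOp_left [CompleteSpace E] (d : D) (a b : 𝔡) :
    κ (skewOp eD p d a) b = -κ a (skewOp eD p d b) := by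
  rw [skewOp_apply, skewOp_apply, map_sub, map_sub, LinearMap.sub_apply, hp.apply_map_left,
    (isManinProj_projAd hp hAd d).apply_map_left]
  ring

theorem apply_skewOp_self [CompleteSpace E] (d : D) (a : 𝔡) : κ (skewOp eD p d a) a = 0 := by
  have h := apply_skewOp_left hp hAd d a a
  rw [hp.symm a] at h
  linarith

theorem apply_projAd_lie [CompleteSpace E] (d : D) (x a b : 𝔡) :
    κ (projAd eD p d ⁅x, a⁆) b + κ (projAd eD p d a) ⁅x, b⁆ =
      -κ x (⁅projAd eD p d a, b⁆ + ⁅a, projAd eD p d b⁆ - ⁅a, b⁆) := by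
  have hswap (c : 𝔡) : κ c ⁅x, b⁆ = -κ x ⁅c, b⁆ := by
    rw [← hp.invariant, ← lie_skew, map_neg, LinearMap.neg_apply, hp.invariant]
  rw [(isManinProj_projAd hp hAd d).apply_map_left, hp.invariant, hp.invariant, hswap, map_sub,
    map_add]
  ring

end SkewOp

section Calculus

variable {E : Type*} [NormedAddCommGroup E] [NormedSpace ℝ E]
  {G : Type*} [TopologicalSpace G] [ChartedSpace E G] [Group G]
  {E' : Type*} [NormedAddCommGroup E'] [NormedSpace ℝ E']
  {D : Type*} [TopologicalSpace D] [ChartedSpace E' D] [Group D] [LieGroup 𝓘(ℝ, E') ∞ D]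
  {𝔞 : Type*} [LieRing 𝔞] [LieAlgebra ℝ 𝔞] {𝔡 : Type*} [LieRing 𝔡] [LieAlgebra ℝ 𝔡]
  {e : LieAlgebraIdent E G 𝔞} {eD : LieAlgebraIdent E' D 𝔡} {ι : 𝔞 →ₗ[ℝ] 𝔡} {ψ : G →* D}

theorem IsIntegration.contMDiff_modelAd_inv (hψ : IsIntegration e eD ι ψ) :
    ContMDiff 𝓘(ℝ, E) 𝓘(ℝ, E' →L[ℝ] E') ∞ (fun y => modelAd E' (ψ y)⁻¹) :=
  PoissonLie.contMDiff_modelAd_inv.comp hψ.smooth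

theorem IsIntegration.rightDeriv_modelAd_inv_apply [LieGroup 𝓘(ℝ, E) ∞ G] [CompleteSpace E']
    (hψ : IsIntegration e eD ι ψ) {A : G → E'} {g : G}
    (hA : MDifferentiableAt 𝓘(ℝ, E) 𝓘(ℝ, E') A g) (x : 𝔞) :
    rightDeriv E (fun y => modelAd E' (ψ y)⁻¹ (A y)) g (e.toModel x) =
      modelAd E' (ψ g)⁻¹ (modelBracket E' D (eD.toModel (ι x)) (A g) +
        rightDeriv E A g (e.toModel x)) := by
  have hT : MDifferentiableAt 𝓘(ℝ, E) 𝓘(ℝ, E' →L[ℝ] E') (fun y => modelAd E' (ψ y)⁻¹) g :=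
    hψ.contMDiff_modelAd_inv.mdifferentiable (by simp) g
  have hconst : rightDeriv E (fun y => modelAd E' (ψ y)⁻¹ (A g)) g (e.toModel x) =
      modelAd E' (ψ g)⁻¹ (modelBracket E' D (eD.toModel (ι x)) (A g)) := by
    rw [hψ.rightDeriv_comp (f := fun d => modelAd E' d⁻¹ (A g))
      ((PoissonLie.contMDiff_modelAd_inv.clm_apply contMDiff_const).mdifferentiable (by simp) _),
      rightDeriv_modelAd_inv]
  rw [rightDeriv, ContinuousLinearMap.comp_apply, modelDeriv_clm_apply_const hT] at hconst
  rw [rightDeriv, ContinuousLinearMap.comp_apply, modelDeriv_clm_apply hT hA, hconst, map_add]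
  rfl

omit [LieGroup 𝓘(ℝ, E') ∞ D] in
theorem rightDeriv_bilinear_apply {F₁ F₂ F : Type*} [NormedAddCommGroup F₁] [NormedSpace ℝ F₁]
    [NormedAddCommGroup F₂] [NormedSpace ℝ F₂] [NormedAddCommGroup F] [NormedSpace ℝ F]
    (L : F₁ →L[ℝ] F₂ →L[ℝ] F) {f : D → F₁} {h : D → F₂} {d : D}
    (hf : MDifferentiableAt 𝓘(ℝ, E') 𝓘(ℝ, F₁) f d) (hh : MDifferentiableAt 𝓘(ℝ, E') 𝓘(ℝ, F₂) h d)
    (w : E') :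
    rightDeriv E' (fun y => L (f y) (h y)) d w =
      L (rightDeriv E' f d w) (h d) + L (f d) (rightDeriv E' h d w) :=
  modelDeriv_bilinear_apply L hf hh _

omit [LieGroup 𝓘(ℝ, E') ∞ D] in
theorem rightDeriv_sub_apply {F : Type*} [NormedAddCommGroup F] [NormedSpace ℝ F] {f h : D → F}
    {d : D} (hf : MDifferentiableAt 𝓘(ℝ, E') 𝓘(ℝ, F) f d)
    (hh : MDifferentiableAt 𝓘(ℝ, E') 𝓘(ℝ, F) h d) (w : E') :
    rightDeriv E' (fun y => f y - h y) d w = rightDeriv E' f d w - rightDeriv E' h d w :=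
  congrArg (fun T : E' →L[ℝ] F => T (rightTransDeriv E' d w)) (mfderiv_sub hf hh)

variable [FiniteDimensional ℝ E'] {κ : LinearMap.BilinForm ℝ 𝔡} {p : 𝔡 →ₗ[ℝ] 𝔡}

variable (eD κ p) in
/-- The bilinear form `(a, b) ↦ κ (p a) b` on the Lie algebra of `D`, on the model space. -/
def LieAlgebraIdent.modelForm : E' →L[ℝ] E' →L[ℝ] ℝ :=
  LinearMap.toContinuousBilinearMap
    (κ.compl₁₂ (p ∘ₗ eD.toModel.symm.toLinearMap) eD.toModel.symm.toLinearMap)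

omit [LieGroup 𝓘(ℝ, E') ∞ D] in
theorem LieAlgebraIdent.modelForm_toModel (a b : 𝔡) :
    eD.modelForm κ p (eD.toModel a) (eD.toModel b) = κ (p a) b := by
  simp [LieAlgebraIdent.modelForm]

theorem LieAlgebraIdent.modelForm_toModel_Ad_inv
    (hAd : ∀ (d : D) (a b : 𝔡), κ (eD.Ad d a) (eD.Ad d b) = κ a b) (d : D) (a b : 𝔡) :
    eD.modelForm κ p (eD.toModel (eD.Ad d⁻¹ a)) (eD.toModel (eD.Ad d⁻¹ b)) =
      κ (projAd eD p d a) b := by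
  rw [eD.modelForm_toModel, projAd_apply, apply_Ad_left hAd]

theorem apply_skewOp_eq_modelForm (hAd : ∀ (d : D) (a b : 𝔡), κ (eD.Ad d a) (eD.Ad d b) = κ a b)
    (d : D) (X Y : E') :
    κ (skewOp eD p d (eD.toModel.symm X)) (eD.toModel.symm Y) =
      eD.modelForm κ p X Y - eD.modelForm κ p (modelAd E' d⁻¹ X) (modelAd E' d⁻¹ Y) := by
  obtain ⟨a, rfl⟩ := eD.toModel.surjective X
  obtain ⟨b, rfl⟩ := eD.toModel.surjective Y
  rw [eD.toModel.symm_apply_apply, eD.toModel.symm_apply_apply, ← eD.toModel_Ad, ← eD.toModel_Ad,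
    eD.modelForm_toModel, eD.modelForm_toModel_Ad_inv hAd, skewOp_apply, map_sub,
    LinearMap.sub_apply]

theorem IsIntegration.contMDiffAt_apply_skewOp (hψ : IsIntegration e eD ι ψ)
    (hAd : ∀ (d : D) (a b : 𝔡), κ (eD.Ad d a) (eD.Ad d b) = κ a b) {A₁ A₂ : G → E'} {g : G}
    (h₁ : ContMDiffAt 𝓘(ℝ, E) 𝓘(ℝ, E') ∞ A₁ g) (h₂ : ContMDiffAt 𝓘(ℝ, E) 𝓘(ℝ, E') ∞ A₂ g) :
    ContMDiffAt 𝓘(ℝ, E) 𝓘(ℝ, ℝ) ∞ (fun y =>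
      κ (skewOp eD p (ψ y) (eD.toModel.symm (A₁ y))) (eD.toModel.symm (A₂ y))) g := by
  have hT := hψ.contMDiff_modelAd_inv g
  have hform {X Y : G → E'} (hX : ContMDiffAt 𝓘(ℝ, E) 𝓘(ℝ, E') ∞ X g)
      (hY : ContMDiffAt 𝓘(ℝ, E) 𝓘(ℝ, E') ∞ Y g) :
      ContMDiffAt 𝓘(ℝ, E) 𝓘(ℝ, ℝ) ∞ (fun y => eD.modelForm κ p (X y) (Y y)) g :=
    (contMDiffAt_const.clm_apply hX).clm_apply hY
  simp only [apply_skewOp_eq_modelForm hAd]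
  exact (hform h₁ h₂).sub (hform (hT.clm_apply h₁) (hT.clm_apply h₂))

theorem IsIntegration.rightDeriv_apply_skewOp [LieGroup 𝓘(ℝ, E) ∞ G]
    (hψ : IsIntegration e eD ι ψ) (hp : IsManinProj κ p)
    (hAd : ∀ (d : D) (a b : 𝔡), κ (eD.Ad d a) (eD.Ad d b) = κ a b) {A₁ A₂ : G → E'} {g : G}
    (h₁ : MDifferentiableAt 𝓘(ℝ, E) 𝓘(ℝ, E') A₁ g) (h₂ : MDifferentiableAt 𝓘(ℝ, E) 𝓘(ℝ, E') A₂ g)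
    {a₁ a₂ b₁ b₂ : 𝔡} {x : 𝔞} (ha₁ : eD.toModel a₁ = A₁ g) (ha₂ : eD.toModel a₂ = A₂ g)
    (hb₁ : eD.toModel b₁ = rightDeriv E A₁ g (e.toModel x))
    (hb₂ : eD.toModel b₂ = rightDeriv E A₂ g (e.toModel x)) :
    rightDeriv E (fun y => κ (skewOp eD p (ψ y) (eD.toModel.symm (A₁ y))) (eD.toModel.symm (A₂ y)))
        g (e.toModel x) =
      κ (skewOp eD p (ψ g) b₁) a₂ + κ (skewOp eD p (ψ g) a₁) b₂ +
        κ (ι x) (⁅projAd eD p (ψ g) a₁, a₂⁆ + ⁅a₁, projAd eD p (ψ g) a₂⁆ - ⁅a₁, a₂⁆) := by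
  have : CompleteSpace E' := FiniteDimensional.complete ℝ E'
  let T (y : G) : E' →L[ℝ] E' := modelAd E' (ψ y)⁻¹
  have hT {A : G → E'} (hA : MDifferentiableAt 𝓘(ℝ, E) 𝓘(ℝ, E') A g) :
      MDifferentiableAt 𝓘(ℝ, E) 𝓘(ℝ, E') (fun y => T y (A y)) g :=
    (hψ.contMDiff_modelAd_inv.mdifferentiable (by simp) g).clm_apply hA
  have hform {X Y : G → E'} (hX : MDifferentiableAt 𝓘(ℝ, E) 𝓘(ℝ, E') X g)
      (hY : MDifferentiableAt 𝓘(ℝ, E) 𝓘(ℝ, E') Y g) :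
      MDifferentiableAt 𝓘(ℝ, E) 𝓘(ℝ, ℝ) (fun y => eD.modelForm κ p (X y) (Y y)) g :=
    (mdifferentiableAt_const.clm_apply hX).clm_apply hY
  have hderiv {A : G → E'} (hA : MDifferentiableAt 𝓘(ℝ, E) 𝓘(ℝ, E') A g) {a b : 𝔡}
      (ha : eD.toModel a = A g) (hb : eD.toModel b = rightDeriv E A g (e.toModel x)) :
      rightDeriv E (fun y => T y (A y)) g (e.toModel x) =
        eD.toModel (eD.Ad (ψ g)⁻¹ (⁅ι x, a⁆ + b)) := by
    rw [hψ.rightDeriv_modelAd_inv_apply hA, eD.toModel_Ad, map_add eD.toModel, eD.toModel_lie, ha,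
      hb]
  have hfst := rightDeriv_bilinear_apply (eD.modelForm κ p) h₁ h₂ (e.toModel x)
  have hsnd := rightDeriv_bilinear_apply (eD.modelForm κ p) (hT h₁) (hT h₂) (e.toModel x)
  rw [← hb₁, ← hb₂, ← ha₁, ← ha₂, eD.modelForm_toModel, eD.modelForm_toModel] at hfst
  rw [hderiv h₁ ha₁ hb₁, hderiv h₂ ha₂ hb₂, ← ha₁, ← ha₂, ← eD.toModel_Ad, ← eD.toModel_Ad,
    eD.modelForm_toModel_Ad_inv hAd, eD.modelForm_toModel_Ad_inv hAd, map_add, map_add, map_add,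
    LinearMap.add_apply] at hsnd
  simp only [apply_skewOp_eq_modelForm hAd]
  rw [rightDeriv_sub_apply (hform h₁ h₂) (hform (hT h₁) (hT h₂)), hfst, hsnd]
  have h := apply_projAd_lie hp hAd (ψ g) (ι x) a₁ a₂
  simp only [skewOp_apply, map_sub, LinearMap.sub_apply] at h ⊢
  linarith

end Calculus

section Induced

variable {E : Type*} [NormedAddCommGroup E] [NormedSpace ℝ E]
  {G : Type*} [TopologicalSpace G] [ChartedSpace E G] [Group G]
  {E' : Type*} [NormedAddCommGroup E'] [NormedSpace ℝ E']
  {D : Type*} [TopologicalSpace D] [ChartedSpace E' D] [Group D]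
  {𝔞 : Type*} [LieRing 𝔞] [LieAlgebra ℝ 𝔞] {𝔡 : Type*} [LieRing 𝔡] [LieAlgebra ℝ 𝔡]

/-- The element `a` of the Lie algebra of `D` represents the covector `α` at `g`: the functional
`κ a ∘ ι` is the right translate of `α` to the identity. -/
def Represents (κ : LinearMap.BilinForm ℝ 𝔡) (e : LieAlgebraIdent E G 𝔞) (ι : 𝔞 →ₗ[ℝ] 𝔡) (g : G)
    (α : Module.Dual ℝ (TangentSpace 𝓘(ℝ, E) g)) (a : 𝔡) : Prop :=
  ∀ x, κ a (ι x) = α (rightTriv E g (e.equiv x))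

/-- `A` is a gradient of `f` with respect to the form `κ`: its value at every point represents the
differential of `f`. It takes values in the model space of `D`, so that it can be differentiated. -/
def IsGradient (κ : LinearMap.BilinForm ℝ 𝔡) (e : LieAlgebraIdent E G 𝔞)
    (eD : LieAlgebraIdent E' D 𝔡) (ι : 𝔞 →ₗ[ℝ] 𝔡) (f : G → ℝ) (A : G → E') : Prop :=
  ∀ g, Represents κ e ι g (dfun E f g) (eD.toModel.symm (A g))

/-- The bivector field `π` on `G` is induced by the Manin projection `p` of the Lie algebra of `D`,
via a homomorphism `ψ : G → D` with differential `ι`: on covectors represented by `a` and `b` it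
takes the value `κ ((p - Ad_{ψ g} p Ad_{ψ g}⁻¹) a) b`. -/
structure IsInducedBivector (eD : LieAlgebraIdent E' D 𝔡) (κ : LinearMap.BilinForm ℝ 𝔡)
    (p : 𝔡 →ₗ[ℝ] 𝔡) (e : LieAlgebraIdent E G 𝔞) (ι : 𝔞 →ₗ[ℝ] 𝔡) (ψ : G →* D)
    (π : TensorField E G) : Prop where
  isManinProj : IsManinProj κ p
  apply_Ad_Ad : ∀ d a b, κ (eD.Ad d a) (eD.Ad d b) = κ a b
  isIntegration : IsIntegration e eD ι ψ
  map_lie : ∀ x y, ι ⁅x, y⁆ = ⁅ι x, ι y⁆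
  exists_lift : ∀ ξ : Module.Dual ℝ 𝔞, ∃ a, ∀ x, κ a (ι x) = ξ x
  skewOp_mem : ∀ g a, ∃ x, ι x = skewOp eD p (ψ g) a
  apply : ∀ g α β a b, Represents κ e ι g α a → Represents κ e ι g β b →
    π g α β = κ (skewOp eD p (ψ g) a) b

variable {e : LieAlgebraIdent E G 𝔞} {eD : LieAlgebraIdent E' D 𝔡} {ι : 𝔞 →ₗ[ℝ] 𝔡} {ψ : G →* D}
  {κ : LinearMap.BilinForm ℝ 𝔡} {p : 𝔡 →ₗ[ℝ] 𝔡} {π : TensorField E G}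

theorem IsGradient.apply_eq_rightDeriv {f : G → ℝ} {A : G → E'} (hA : IsGradient κ e eD ι f A)
    (g : G) (x : 𝔞) : κ (eD.toModel.symm (A g)) (ι x) = rightDeriv E f g (e.toModel x) :=
  hA g x

theorem IsGradient.apply_rightDeriv [FiniteDimensional ℝ E'] {f : G → ℝ} {A : G → E'}
    (hA : IsGradient κ e eD ι f A) {g : G} (hdiff : MDifferentiableAt 𝓘(ℝ, E) 𝓘(ℝ, E') A g)
    (v : E) (z : 𝔞) :
    κ (eD.toModel.symm (rightDeriv E A g v)) (ι z) =
      rightDeriv E (fun y => rightDeriv E f y (e.toModel z)) g v := by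
  let L : E' →L[ℝ] ℝ := (κ.flip (ι z) ∘ₗ eD.toModel.symm.toLinearMap).toContinuousLinearMap
  have hL : (fun y => rightDeriv E f y (e.toModel z)) = fun y => L (A y) :=
    funext fun y => (hA.apply_eq_rightDeriv y z).symm
  rw [hL, rightDeriv, rightDeriv, modelDeriv_continuousLinearMap_comp L hdiff]
  rfl

theorem IsGradient.apply_rightDeriv_sub [LieGroup 𝓘(ℝ, E) ∞ G] [CompleteSpace E]
    [FiniteDimensional ℝ E'] {f : G → ℝ} {A : G → E'} (hA : IsGradient κ e eD ι f A)
    (hι : ∀ x y, ι ⁅x, y⁆ = ⁅ι x, ι y⁆) {g : G} (hf : SmoothAt E f g)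
    (hdiff : MDifferentiableAt 𝓘(ℝ, E) 𝓘(ℝ, E') A g) (x z : 𝔞) :
    κ (eD.toModel.symm (rightDeriv E A g (e.toModel x))) (ι z) -
        κ (eD.toModel.symm (rightDeriv E A g (e.toModel z))) (ι x) =
      κ (eD.toModel.symm (A g)) ⁅ι x, ι z⁆ := by
  rw [hA.apply_rightDeriv hdiff, hA.apply_rightDeriv hdiff, ← hι, hA.apply_eq_rightDeriv,
    e.toModel_lie, rightDeriv_modelBracket hf]

theorem exists_isGradient [LieGroup 𝓘(ℝ, E) ∞ G] [FiniteDimensional ℝ E]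
    (hlift : ∀ ξ : Module.Dual ℝ 𝔞, ∃ a, ∀ x, κ a (ι x) = ξ x) (eD : LieAlgebraIdent E' D 𝔡)
    (f : G → ℝ) :
    ∃ A : G → E', IsGradient κ e eD ι f A ∧
      ∀ g, SmoothAt E f g → ContMDiffAt 𝓘(ℝ, E) 𝓘(ℝ, E') ∞ A g := by
  let T : E' →ₗ[ℝ] E →L[ℝ] ℝ := LinearMap.toContinuousLinearMap.toLinearMap ∘ₗ
    κ.compl₁₂ eD.toModel.symm.toLinearMap (ι ∘ₗ e.toModel.symm.toLinearMap)
  have hT : Function.Surjective T := fun χ => by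
    obtain ⟨a, ha⟩ := hlift (χ.toLinearMap ∘ₗ e.toModel.toLinearMap)
    exact ⟨eD.toModel a, ContinuousLinearMap.ext fun v => by
      simpa [T] using ha (e.toModel.symm v)⟩
  obtain ⟨S, hS⟩ := T.exists_rightInverse_of_surjective (LinearMap.range_eq_top.2 hT)
  refine ⟨fun y => S (rightDeriv E f y), fun y x => ?_, fun g hf => ?_⟩
  · have h := congrArg (fun χ : E →L[ℝ] ℝ => χ (e.toModel x))
      (LinearMap.congr_fun hS (rightDeriv E f y))
    change κ (eD.toModel.symm (S (rightDeriv E f y))) (ι x) = rightDeriv E f y (e.toModel x)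
    simpa [T] using h
  · exact S.toContinuousLinearMap.contDiff.contMDiff.contMDiffAt.comp g (contMDiffAt_rightDeriv hf)

namespace IsInducedBivector

theorem exists_represents (h : IsInducedBivector eD κ p e ι ψ π) (g : G)
    (α : Module.Dual ℝ (TangentSpace 𝓘(ℝ, E) g)) : ∃ a, Represents κ e ι g α a :=
  h.exists_lift (α ∘ₗ rightTriv E g ∘ₗ e.equiv.toLinearMap)

theorem poissonBracket_eq (h : IsInducedBivector eD κ p e ι ψ π) {f₁ f₂ : G → ℝ} {A₁ A₂ : G → E'}
    (hA₁ : IsGradient κ e eD ι f₁ A₁) (hA₂ : IsGradient κ e eD ι f₂ A₂) :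
    poissonBracket π f₁ f₂ =
      fun g => κ (skewOp eD p (ψ g) (eD.toModel.symm (A₁ g))) (eD.toModel.symm (A₂ g)) :=
  funext fun g => h.apply _ _ _ _ _ (hA₁ g) (hA₂ g)

variable [LieGroup 𝓘(ℝ, E) ∞ G] [LieGroup 𝓘(ℝ, E') ∞ D]

omit [LieGroup 𝓘(ℝ, E) ∞ G] in
theorem neg (h : IsInducedBivector eD κ p e ι ψ π) :
    IsInducedBivector eD κ (LinearMap.id - p) e ι ψ (-π) where
  isManinProj := h.isManinProj.compl
  apply_Ad_Ad := h.apply_Ad_Ad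
  isIntegration := h.isIntegration
  map_lie := h.map_lie
  exists_lift := h.exists_lift
  skewOp_mem g a := by
    obtain ⟨x, hx⟩ := h.skewOp_mem g a
    exact ⟨-x, by rw [map_neg, hx, skewOp_id_sub]⟩
  apply g α β a b ha hb := by
    rw [Pi.neg_apply, LinearMap.neg_apply, LinearMap.neg_apply, h.apply g α β a b ha hb,
      skewOp_id_sub, map_neg, LinearMap.neg_apply]

omit [LieGroup 𝓘(ℝ, E) ∞ G] in
theorem alt [CompleteSpace E'] (h : IsInducedBivector eD κ p e ι ψ π) (g : G)
    (α : Module.Dual ℝ (TangentSpace 𝓘(ℝ, E) g)) : π g α α = 0 := by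
  obtain ⟨a, ha⟩ := h.exists_represents g α
  rw [h.apply g α α a a ha ha, apply_skewOp_self h.isManinProj h.apply_Ad_Ad]

theorem isMultiplicative (h : IsInducedBivector eD κ p e ι ψ π) : IsMultiplicative π := by
  intro g k α β
  have hleft {α : Module.Dual ℝ (TangentSpace 𝓘(ℝ, E) (g * k))} {a : 𝔡}
      (ha : Represents κ e ι (g * k) α a) :
      Represents κ e ι k (α ∘ₗ dLeft E g k) (eD.Ad (ψ g)⁻¹ a) := fun x => by
    rw [LinearMap.comp_apply, e.dLeft_rightTriv, ← ha, h.isIntegration.map_Ad,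
      apply_Ad_right h.apply_Ad_Ad]
  have hright {α : Module.Dual ℝ (TangentSpace 𝓘(ℝ, E) (g * k))} {a : 𝔡}
      (ha : Represents κ e ι (g * k) α a) : Represents κ e ι g (α ∘ₗ dRight E k g) a := fun x => by
    rw [LinearMap.comp_apply, dRight_rightTriv, ← ha]
  obtain ⟨a, ha⟩ := h.exists_represents _ α
  obtain ⟨b, hb⟩ := h.exists_represents _ β
  rw [h.apply _ _ _ _ _ ha hb, h.apply _ _ _ _ _ (hleft ha) (hleft hb),
    h.apply _ _ _ _ _ (hright ha) (hright hb), map_mul, skewOp_mul, map_add, LinearMap.add_apply,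
    apply_Ad_left h.apply_Ad_Ad, add_comm]

theorem map_apply {ϖ : TensorField E' D} (h : IsInducedBivector eD κ p e ι ψ π)
    (hD : IsInducedBivector eD κ p eD LinearMap.id (MonoidHom.id D) ϖ) (g : G)
    (α β : Module.Dual ℝ (TangentSpace 𝓘(ℝ, E') (ψ g))) :
    ϖ (ψ g) α β = π g (α ∘ₗ dmap E E' ψ g) (β ∘ₗ dmap E E' ψ g) := by
  have hcomp {α : Module.Dual ℝ (TangentSpace 𝓘(ℝ, E') (ψ g))} {a : 𝔡}
      (ha : Represents κ eD LinearMap.id (ψ g) α a) :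
      Represents κ e ι g (α ∘ₗ dmap E E' ψ g) a := fun x => by
    rw [LinearMap.comp_apply, h.isIntegration.dmap_rightTriv, ← ha, LinearMap.id_apply]
  obtain ⟨a, ha⟩ := hD.exists_represents _ α
  obtain ⟨b, hb⟩ := hD.exists_represents _ β
  rw [hD.apply _ _ _ _ _ ha hb, h.apply _ _ _ _ _ (hcomp ha) (hcomp hb), MonoidHom.id_apply]

variable [FiniteDimensional ℝ E] [FiniteDimensional ℝ E']

omit [LieGroup 𝓘(ℝ, E') ∞ D] [FiniteDimensional ℝ E'] in
theorem poissonBracket_eq_rightDeriv (h : IsInducedBivector eD κ p e ι ψ π) {f : G → ℝ}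
    {A : G → E'} (hA : IsGradient κ e eD ι f A) (F : G → ℝ) {g : G} {x : 𝔞}
    (hx : ι x = skewOp eD p (ψ g) (eD.toModel.symm (A g))) :
    poissonBracket π f F g = rightDeriv E F g (e.toModel x) := by
  obtain ⟨A', hA', -⟩ := exists_isGradient (e := e) h.exists_lift eD F
  rw [congrFun (h.poissonBracket_eq hA hA') g, ← hx, h.isManinProj.symm, hA'.apply_eq_rightDeriv]

theorem smoothAt_poissonBracket (h : IsInducedBivector eD κ p e ι ψ π) {f₁ f₂ : G → ℝ} {g : G}
    (h₁ : SmoothAt E f₁ g) (h₂ : SmoothAt E f₂ g) : SmoothAt E (poissonBracket π f₁ f₂) g := by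
  obtain ⟨A₁, hA₁, hsmooth₁⟩ := exists_isGradient (e := e) h.exists_lift eD f₁
  obtain ⟨A₂, hA₂, hsmooth₂⟩ := exists_isGradient (e := e) h.exists_lift eD f₂
  rw [h.poissonBracket_eq hA₁ hA₂]
  exact h.isIntegration.contMDiffAt_apply_skewOp h.apply_Ad_Ad (hsmooth₁ g h₁) (hsmooth₂ g h₂)

theorem poissonBracket_poissonBracket (h : IsInducedBivector eD κ p e ι ψ π) {f₁ f₂ f₃ : G → ℝ}
    {A₁ A₂ A₃ : G → E'} (hA₁ : IsGradient κ e eD ι f₁ A₁) (hA₂ : IsGradient κ e eD ι f₂ A₂)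
    (hA₃ : IsGradient κ e eD ι f₃ A₃) {g : G} (hd₂ : MDifferentiableAt 𝓘(ℝ, E) 𝓘(ℝ, E') A₂ g)
    (hd₃ : MDifferentiableAt 𝓘(ℝ, E) 𝓘(ℝ, E') A₃ g) {a₁ a₂ a₃ : 𝔡} (ha₁ : eD.toModel a₁ = A₁ g)
    (ha₂ : eD.toModel a₂ = A₂ g) (ha₃ : eD.toModel a₃ = A₃ g) {x₁ x₂ x₃ : 𝔞}
    (hx₁ : ι x₁ = skewOp eD p (ψ g) a₁) (hx₂ : ι x₂ = skewOp eD p (ψ g) a₂)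
    (hx₃ : ι x₃ = skewOp eD p (ψ g) a₃) :
    poissonBracket π f₁ (poissonBracket π f₂ f₃) g =
      κ (eD.toModel.symm (rightDeriv E A₃ g (e.toModel x₁))) (ι x₂) -
          κ (eD.toModel.symm (rightDeriv E A₂ g (e.toModel x₁))) (ι x₃) +
        κ (ι x₁) (⁅projAd eD p (ψ g) a₂, a₃⁆ + ⁅a₂, projAd eD p (ψ g) a₃⁆ - ⁅a₂, a₃⁆) := by
  have : CompleteSpace E' := FiniteDimensional.complete ℝ E'
  rw [h.poissonBracket_eq_rightDeriv hA₁ _ (by rw [hx₁, ← ha₁, eD.toModel.symm_apply_apply]),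
    h.poissonBracket_eq hA₂ hA₃,
    h.isIntegration.rightDeriv_apply_skewOp h.isManinProj h.apply_Ad_Ad hd₂ hd₃ ha₂ ha₃
      (eD.toModel.apply_symm_apply _) (eD.toModel.apply_symm_apply _),
    apply_skewOp_left h.isManinProj h.apply_Ad_Ad, ← hx₂, ← hx₃, h.isManinProj.symm (ι x₂)]
  ring

theorem jacobi (h : IsInducedBivector eD κ p e ι ψ π) {f₁ f₂ f₃ : G → ℝ} {g : G}
    (h₁ : SmoothAt E f₁ g) (h₂ : SmoothAt E f₂ g) (h₃ : SmoothAt E f₃ g) :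
    poissonBracket π f₁ (poissonBracket π f₂ f₃) g +
        poissonBracket π f₂ (poissonBracket π f₃ f₁) g +
      poissonBracket π f₃ (poissonBracket π f₁ f₂) g = 0 := by
  have : CompleteSpace E := FiniteDimensional.complete ℝ E
  have : CompleteSpace E' := FiniteDimensional.complete ℝ E'
  have hgradient {f : G → ℝ} (hf : SmoothAt E f g) : ∃ (A : G → E') (a : 𝔡) (x : 𝔞),
      IsGradient κ e eD ι f A ∧ MDifferentiableAt 𝓘(ℝ, E) 𝓘(ℝ, E') A g ∧ eD.toModel a = A g ∧
        ι x = skewOp eD p (ψ g) a := by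
    obtain ⟨A, hA, hsmooth⟩ := exists_isGradient (e := e) h.exists_lift eD f
    obtain ⟨x, hx⟩ := h.skewOp_mem g (eD.toModel.symm (A g))
    exact ⟨A, _, x, hA, (hsmooth g hf).mdifferentiableAt (by simp),
      eD.toModel.apply_symm_apply _, hx⟩
  obtain ⟨A₁, a₁, x₁, hA₁, hd₁, ha₁, hx₁⟩ := hgradient h₁
  obtain ⟨A₂, a₂, x₂, hA₂, hd₂, ha₂, hx₂⟩ := hgradient h₂
  obtain ⟨A₃, a₃, x₃, hA₃, hd₃, ha₃, hx₃⟩ := hgradient h₃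
  have hsymm₁ := hA₁.apply_rightDeriv_sub h.map_lie h₁ hd₁ x₂ x₃
  have hsymm₂ := hA₂.apply_rightDeriv_sub h.map_lie h₂ hd₂ x₃ x₁
  have hsymm₃ := hA₃.apply_rightDeriv_sub h.map_lie h₃ hd₃ x₁ x₂
  have hcyclic := IsManinProj.sub_cyclic_sum_eq_zero h.isManinProj
    (isManinProj_projAd h.isManinProj h.apply_Ad_Ad (ψ g)) (r := skewOp eD p (ψ g)) rfl a₁ a₂ a₃
  rw [← hx₁, ← hx₂, ← hx₃] at hcyclic
  rw [← ha₁, eD.toModel.symm_apply_apply] at hsymm₁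
  rw [← ha₂, eD.toModel.symm_apply_apply] at hsymm₂
  rw [← ha₃, eD.toModel.symm_apply_apply] at hsymm₃
  rw [h.poissonBracket_poissonBracket hA₁ hA₂ hA₃ hd₂ hd₃ ha₁ ha₂ ha₃ hx₁ hx₂ hx₃,
    h.poissonBracket_poissonBracket hA₂ hA₃ hA₁ hd₃ hd₁ ha₂ ha₃ ha₁ hx₂ hx₃ hx₁,
    h.poissonBracket_poissonBracket hA₃ hA₁ hA₂ hd₁ hd₂ ha₃ ha₁ ha₂ hx₃ hx₁ hx₂]
  linarith

theorem isPoissonLieGroup (h : IsInducedBivector eD κ p e ι ψ π) : IsPoissonLieGroup π where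
  poisson :=
    { alt := have : CompleteSpace E' := FiniteDimensional.complete ℝ E'; h.alt
      smooth := fun _ _ _ => h.smoothAt_poissonBracket
      jacobi := fun _ _ _ _ => h.jacobi }
  multiplicative := h.isMultiplicative

omit [FiniteDimensional ℝ E] in
theorem hasLieBialgebra (h : IsInducedBivector eD κ p e ι ψ π) {B : LieBialgebra 𝔞}
    {s : Module.Dual ℝ 𝔞 → 𝔡} (hps : ∀ ξ, p (s ξ) = 0) (hs : ∀ ξ x, κ (s ξ) (ι x) = ξ x)
    (hB : ∀ x ξ η, B.cobracket x ξ η = -κ (ι x) ⁅s ξ, s η⁆) : HasLieBialgebra e π B := by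
  intro α β
  let a := s (α ∘ₗ e.equiv.toLinearMap)
  let b := s (β ∘ₗ e.equiv.toLinearMap)
  have hrepr (γ : Module.Dual ℝ (GroupLieAlgebra 𝓘(ℝ, E) G)) (g : G) :
      Represents κ e ι g (γ ∘ₗ rightTrivInv E g) (s (γ ∘ₗ e.equiv.toLinearMap)) := fun x => by
    rw [hs, LinearMap.comp_apply, LinearMap.comp_apply, rightTrivInv_rightTriv]
    rfl
  have htriv : rightTrivialized π α β = fun g => κ (skewOp eD p (ψ g)
      (eD.toModel.symm (eD.toModel a))) (eD.toModel.symm (eD.toModel b)) := by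
    ext g
    rw [eD.toModel.symm_apply_apply, eD.toModel.symm_apply_apply]
    exact h.apply _ _ _ _ _ (hrepr α g) (hrepr β g)
  rw [htriv]
  refine ⟨(h.isIntegration.contMDiffAt_apply_skewOp h.apply_Ad_Ad contMDiffAt_const
    contMDiffAt_const).mdifferentiableAt (by simp), fun x => ?_⟩
  have hconst (c : E') : eD.toModel 0 = rightDeriv E (fun _ : G => c) 1 (e.toModel x) := by
    rw [rightDeriv_one, modelDeriv_const, map_zero]
    rfl
  have hderiv := h.isIntegration.rightDeriv_apply_skewOp h.isManinProj h.apply_Ad_Ad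
    mdifferentiableAt_const mdifferentiableAt_const rfl rfl (hconst (eD.toModel a))
    (hconst (eD.toModel b))
  rw [rightDeriv_one, map_one, skewOp_one, projAd_one, hps, hps] at hderiv
  refine hderiv.trans ?_
  rw [hB]
  simp only [LinearMap.zero_apply, map_zero, zero_lie, lie_zero, zero_add, zero_sub, map_neg, a, b]

end IsInducedBivector

end Induced

end PoissonLie

namespace LieBialgebra

variable {𝔤 : Type*} [LieRing 𝔤] [LieAlgebra ℝ 𝔤] (B : LieBialgebra 𝔤)

theorem prg_inl (x : 𝔤) : B.prg (B.inl x) = x := rfl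

theorem prgs_inl (x : 𝔤) : B.prgs (B.inl x) = 0 := rfl

theorem prg_inr (ξ : B.DualAlg) : B.prg (B.inr ξ) = 0 := rfl

theorem prgs_inr (ξ : B.DualAlg) : B.prgs (B.inr ξ) = ξ := rfl

theorem inl_prg_add_inr_prgs (a : B.Double) : B.inl (B.prg a) + B.inr (B.prgs a) = a :=
  Prod.ext (add_zero (B.prg a)) (zero_add (B.prgs a))

theorem sub_inl_prg (a : B.Double) : a - B.inl (B.prg a) = B.inr (B.prgs a) :=
  sub_eq_of_eq_add' (B.inl_prg_add_inr_prgs a).symm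

theorem sub_inr_prgs (a : B.Double) : a - B.inr (B.prgs a) = B.inl (B.prg a) :=
  sub_eq_of_eq_add (B.inl_prg_add_inr_prgs a).symm

theorem id_sub_inl_comp_prg : LinearMap.id - B.inl ∘ₗ B.prg = B.inr ∘ₗ B.prgs :=
  LinearMap.ext B.sub_inl_prg

theorem coad_zero_left (ξ : B.DualAlg) : B.coad 0 ξ = 0 := by simp [coad]

theorem coad_zero_right (x : 𝔤) : B.coad x 0 = 0 := by simp [coad]

variable [FiniteDimensional ℝ 𝔤]

theorem pairing_symm (a b : B.Double) : B.pairing a b = B.pairing b a := by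
  rw [B.pairing_apply, B.pairing_apply, add_comm]

theorem pairing_inl_right (a : B.Double) (x : 𝔤) :
    B.pairing a (B.inl x) = B.toDual (B.prgs a) x := by
  rw [B.pairing_apply, prg_inl, prgs_inl, map_zero, LinearMap.zero_apply, zero_add]

theorem pairing_inr_right (a : B.Double) (ξ : B.DualAlg) :
    B.pairing a (B.inr ξ) = B.toDual ξ (B.prg a) := by
  rw [B.pairing_apply, prg_inr, prgs_inr, map_zero, add_zero]

theorem pairing_inl_inl (x y : 𝔤) : B.pairing (B.inl x) (B.inl y) = 0 := by
  rw [pairing_inl_right, prgs_inl, map_zero, LinearMap.zero_apply]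

theorem pairing_inr_inr (ξ η : B.DualAlg) : B.pairing (B.inr ξ) (B.inr η) = 0 := by
  rw [pairing_inr_right, prg_inr, map_zero]

theorem coadDual_zero_left (x : 𝔤) : B.coadDual 0 x = 0 := by simp [coadDual]

theorem coadDual_zero_right (ξ : B.DualAlg) : B.coadDual ξ 0 = 0 := by simp [coadDual]

theorem inl_lie (x y : 𝔤) : B.inl ⁅x, y⁆ = ⁅B.inl x, B.inl y⁆ := by
  apply B.double_ext <;> intro z
  · simp [B.prg_lie, prg_inl, prgs_inl, coadDual_zero_left]
  · simp [B.prgs_lie, prg_inl, prgs_inl, coad_zero_right]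

theorem inr_lie (ξ η : B.DualAlg) : B.inr ⁅ξ, η⁆ = ⁅B.inr ξ, B.inr η⁆ := by
  apply B.double_ext <;> intro z
  · simp [B.prg_lie, prg_inr, prgs_inr, coadDual_zero_right]
  · simp [B.prgs_lie, prg_inr, prgs_inr, coad_zero_left]

theorem isManinProj_inl_comp_prg : PoissonLie.IsManinProj B.pairing (B.inl ∘ₗ B.prg) where
  symm := B.pairing_symm
  invariant := B.pairing_lie
  isotropic _ _ := B.pairing_inl_inl _ _
  isotropic_compl a b := by
    simp only [LinearMap.comp_apply, sub_inl_prg, pairing_inr_inr]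
  map_lie_map a b := by simp only [LinearMap.comp_apply, ← inl_lie, prg_inl]
  map_lie_compl a b := by
    simp only [LinearMap.comp_apply, sub_inl_prg, ← inr_lie, prg_inr, map_zero]

theorem isManinProj_inr_comp_prgs : PoissonLie.IsManinProj B.pairing (B.inr ∘ₗ B.prgs) :=
  B.id_sub_inl_comp_prg ▸ B.isManinProj_inl_comp_prg.compl

theorem pairing_inr_toDual_symm_inl (ξ : Module.Dual ℝ 𝔤) (x : 𝔤) :
    B.pairing (B.inr (B.toDual.symm ξ)) (B.inl x) = ξ x := by
  rw [pairing_inl_right, prgs_inr, LinearEquiv.apply_symm_apply]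

theorem pairing_inl_ofBidual_inr (χ : Module.Dual ℝ B.DualAlg) (ξ : B.DualAlg) :
    B.pairing (B.inl (B.ofBidual χ)) (B.inr ξ) = χ ξ := by
  rw [pairing_inr_right, prg_inl, B.toDual_ofBidual]

theorem exists_pairing_eq (χ : Module.Dual ℝ B.Double) : ∃ a, ∀ x, B.pairing a x = χ x := by
  refine ⟨B.inr (B.toDual.symm (χ ∘ₗ B.inl)) + B.inl (B.ofBidual (χ ∘ₗ B.inr)), fun x => ?_⟩
  rw [← B.inl_prg_add_inr_prgs x]
  simp only [map_add, LinearMap.add_apply, pairing_inl_inl, pairing_inr_inr,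
    pairing_inr_toDual_symm_inl, pairing_inl_ofBidual_inr, LinearMap.comp_apply, add_zero, zero_add]

theorem cobracket_eq_neg_pairing_lie (x : 𝔤) (ξ η : Module.Dual ℝ 𝔤) :
    B.cobracket x ξ η =
      -B.pairing (B.inl x) ⁅B.inr (B.toDual.symm ξ), B.inr (B.toDual.symm η)⁆ := by
  rw [← inr_lie, pairing_inr_right, prg_inl, toDual_lie, neg_neg, LinearEquiv.apply_symm_apply,
    LinearEquiv.apply_symm_apply]

theorem dual_cobracket_eq_neg_pairing_lie (ξ : B.DualAlg) (χ χ' : Module.Dual ℝ B.DualAlg) :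
    B.dual.cobracket ξ χ χ' =
      -B.pairing (B.inr ξ) ⁅B.inl (B.ofBidual χ), B.inl (B.ofBidual χ')⁆ := by
  rw [← inl_lie, pairing_inl_right, prgs_inr]
  rfl

theorem pairing_inl_eq_sum {ι : Type*} [Fintype ι] (u : Module.Basis ι ℝ 𝔤) (x : 𝔤)
    (a : B.Double) : B.pairing (B.inl x) a = ∑ i, u.coord i x * B.toDual (B.prgs a) (u i) := by
  rw [pairing_symm, pairing_inl_right]
  conv_lhs => rw [← u.sum_repr x]
  simp only [map_sum, map_smul, smul_eq_mul, Module.Basis.coord_apply]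

theorem rmatrix_pairing {ι : Type*} [Fintype ι] (u : Module.Basis ι ℝ 𝔤) (a b : B.Double) :
    PoissonLie.rmatrix B u (B.pairing a) (B.pairing b) =
      B.pairing (B.inl (B.prg a)) b - (1 / 2 : ℝ) * B.pairing a b := by
  have hsum : PoissonLie.rmatrix B u (B.pairing a) (B.pairing b) =
      (1 / 2 : ℝ) * (B.pairing (B.inl (B.prg a)) b - B.pairing (B.inl (B.prg b)) a) := by
    rw [B.pairing_inl_eq_sum u, B.pairing_inl_eq_sum u, ← Finset.sum_sub_distrib]
    simp only [PoissonLie.rmatrix, PoissonLie.wedge, LinearMap.smul_apply, LinearMap.sum_apply,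
      LinearMap.sub_apply, LinearMap.BilinForm.linMulLin_apply, Module.Dual.eval_apply,
      pairing_inr_right, pairing_inl_right, LinearEquiv.apply_symm_apply, smul_eq_mul]
    congr 1
    exact Finset.sum_congr rfl fun i _ => by ring
  have hswap := B.isManinProj_inl_comp_prg.apply_map_left b a
  rw [LinearMap.comp_apply, LinearMap.comp_apply, B.pairing_symm b, B.pairing_symm b] at hswap
  rw [hsum, hswap]
  ring

end LieBialgebra

namespace PoissonLie

section Double

variable {𝔤 : Type*} [LieRing 𝔤] [LieAlgebra ℝ 𝔤] [FiniteDimensional ℝ 𝔤] {B : LieBialgebra 𝔤}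
  {ED : Type*} [NormedAddCommGroup ED] [NormedSpace ℝ ED]
  {D : Type*} [TopologicalSpace D] [ChartedSpace ED D] [Group D] [LieGroup 𝓘(ℝ, ED) ∞ D]
  {E : Type*} [NormedAddCommGroup E] [NormedSpace ℝ E]
  {G : Type*} [TopologicalSpace G] [ChartedSpace E G] [Group G] [LieGroup 𝓘(ℝ, E) ∞ G]
  (eD : QuadraticIdent B ED D)

theorem isInducedBivector_piD {ι : Type*} [Fintype ι] (u : Module.Basis ι ℝ 𝔤) :
    IsInducedBivector eD.toLieAlgebraIdent B.pairing (B.inl ∘ₗ B.prg) eD.toLieAlgebraIdent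
      LinearMap.id (MonoidHom.id D) (piD eD u) where
  isManinProj := B.isManinProj_inl_comp_prg
  apply_Ad_Ad := eD.pairing_Ad
  isIntegration := .id _
  map_lie _ _ := rfl
  exists_lift := B.exists_pairing_eq
  skewOp_mem _ _ := ⟨_, rfl⟩
  apply d α β a b ha hb := by
    have hright {α : Module.Dual ℝ (TangentSpace 𝓘(ℝ, ED) d)} {a : B.Double}
        (ha : Represents B.pairing eD.toLieAlgebraIdent LinearMap.id d α a) :
        (rightTriv ED d ∘ₗ eD.equiv.toLinearMap).dualMap α = B.pairing a :=
      LinearMap.ext fun x => (ha x).symm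
    have hleft {α : Module.Dual ℝ (TangentSpace 𝓘(ℝ, ED) d)} {a : B.Double}
        (ha : Represents B.pairing eD.toLieAlgebraIdent LinearMap.id d α a) :
        (leftTriv ED d ∘ₗ eD.equiv.toLinearMap).dualMap α = B.pairing (eD.Ad d⁻¹ a) :=
      LinearMap.ext fun x => by
        rw [← apply_Ad_right eD.pairing_Ad]
        exact (congrArg α (eD.leftTriv_eq_rightTriv_Ad d x)).trans (ha _).symm
    rw [piD, LinearMap.sub_apply, LinearMap.sub_apply]
    simp only [LinearMap.compl₁₂_apply, hright ha, hright hb, hleft ha, hleft hb,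
      B.rmatrix_pairing, eD.pairing_Ad]
    rw [MonoidHom.id_apply, skewOp_apply, projAd_apply, map_sub, LinearMap.sub_apply,
      apply_Ad_left eD.pairing_Ad]
    simp only [LinearMap.comp_apply]
    ring

theorem leftCoord_eq_of_represents {eG : LieAlgebraIdent E G 𝔤} {φ : G →* D}
    (hφ : IsIntegration eG eD.toLieAlgebraIdent B.inl φ) {g : G}
    {α : Module.Dual ℝ (TangentSpace 𝓘(ℝ, E) g)} {a : B.Double}
    (ha : Represents B.pairing eG B.inl g α a) :
    leftCoord eG g α = B.prgs (eD.Ad (φ g)⁻¹ a) := by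
  refine B.dual_ext fun x => ?_
  rw [← B.pairing_inl_right, ← apply_Ad_right eD.pairing_Ad, ← hφ.map_Ad, ha]
  exact congrArg α (eG.leftTriv_eq_rightTriv_Ad g x)

omit [LieGroup 𝓘(ℝ, E) ∞ G] in
theorem rightCoord_eq_of_represents {eS : LieAlgebraIdent E G B.DualAlg} {g : G}
    {α : Module.Dual ℝ (TangentSpace 𝓘(ℝ, E) g)} {a : B.Double}
    (ha : Represents B.pairing eS B.inr g α a) : rightCoord eS g α = B.prg a :=
  B.ofBidual_eq _ _ fun ξ => by
    rw [← B.pairing_inr_right, ha]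
    rfl

theorem skewOp_inl_comp_prg {eG : LieAlgebraIdent E G 𝔤} {φ : G →* D}
    (hφ : IsIntegration eG eD.toLieAlgebraIdent B.inl φ) (g : G) (a : B.Double) :
    skewOp eD.toLieAlgebraIdent (B.inl ∘ₗ B.prg) (φ g) a =
      B.inl (B.prg a - eG.Ad g (B.prg (eD.Ad (φ g)⁻¹ a))) := by
  rw [map_sub, hφ.map_Ad]
  rfl

theorem skewOp_inr_comp_prgs {eS : LieAlgebraIdent E G B.DualAlg} {φ : G →* D}
    (hφ : IsIntegration eS eD.toLieAlgebraIdent B.inr φ) (g : G) (a : B.Double) :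
    skewOp eD.toLieAlgebraIdent (B.inr ∘ₗ B.prgs) (φ g) a =
      B.inr (B.prgs a - eS.Ad g (B.prgs (eD.Ad (φ g)⁻¹ a))) := by
  rw [map_sub, hφ.map_Ad]
  rfl

theorem isInducedBivector_piG (eG : LieAlgebraIdent E G 𝔤) (φ : G →* D)
    (hφ : IsIntegration eG eD.toLieAlgebraIdent B.inl φ) :
    IsInducedBivector eD.toLieAlgebraIdent B.pairing (B.inl ∘ₗ B.prg) eG B.inl φ
      (piG eD eG φ) where
  isManinProj := B.isManinProj_inl_comp_prg
  apply_Ad_Ad := eD.pairing_Ad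
  isIntegration := hφ
  map_lie := B.inl_lie
  exists_lift ξ := ⟨_, B.pairing_inr_toDual_symm_inl ξ⟩
  skewOp_mem g a := ⟨_, (skewOp_inl_comp_prg eD hφ g a).symm⟩
  apply g α β a b ha hb := by
    have hAd {α : Module.Dual ℝ (TangentSpace 𝓘(ℝ, E) g)} {a : B.Double}
        (ha : Represents B.pairing eG B.inl g α a) : eD.Ad (φ g) (B.inr (leftCoord eG g α)) =
          a - B.inl (eG.Ad g (B.prg (eD.Ad (φ g)⁻¹ a))) := by
      rw [leftCoord_eq_of_represents eD hφ ha, ← B.sub_inl_prg, map_sub, eD.Ad_Ad_inv, hφ.map_Ad]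
    rw [piG, LinearMap.compl₁₂_apply]
    simp only [LinearMap.comp_apply]
    rw [hAd ha, hAd hb, skewOp_inl_comp_prg eD hφ, map_sub B.prg, map_sub B.prgs, B.prg_inl,
      B.prgs_inl, sub_zero, ← B.sub_inl_prg, map_sub (B.pairing _), B.pairing_inl_inl, sub_zero]

theorem isInducedBivector_piGs [CompleteSpace ED] (eS : LieAlgebraIdent E G B.DualAlg) (φ : G →* D)
    (hφ : IsIntegration eS eD.toLieAlgebraIdent B.inr φ) :
    IsInducedBivector eD.toLieAlgebraIdent B.pairing (B.inr ∘ₗ B.prgs) eS B.inr φ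
      (piGs eD eS φ) where
  isManinProj := B.isManinProj_inr_comp_prgs
  apply_Ad_Ad := eD.pairing_Ad
  isIntegration := hφ
  map_lie := B.inr_lie
  exists_lift χ := ⟨_, B.pairing_inl_ofBidual_inr χ⟩
  skewOp_mem g a := ⟨_, (skewOp_inr_comp_prgs eD hφ g a).symm⟩
  apply g α β a b ha hb := by
    have hprgs : eD.Ad (φ g) (B.inr (B.prgs (eD.Ad (φ g)⁻¹ (B.inl (B.prg b))))) =
        -skewOp eD.toLieAlgebraIdent (B.inr ∘ₗ B.prgs) (φ g) b := by
      rw [← B.sub_inr_prgs b, map_sub, ← map_inv, ← hφ.map_Ad g⁻¹, map_sub B.prgs, B.prgs_inr,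
        ← hφ.map_Ad, map_sub (eS.Ad g), eS.Ad_Ad_inv, skewOp_inr_comp_prgs eD hφ, map_inv,
        ← map_neg, neg_sub]
    rw [piGs, LinearMap.compl₁₂_apply]
    simp only [LinearMap.comp_apply]
    rw [rightCoord_eq_of_represents ha, rightCoord_eq_of_represents hb, B.pairing_inr_right,
      B.prg_inl, ← B.pairing_inr_right, ← apply_Ad_right eD.pairing_Ad, hprgs]
    rw [map_neg, ← B.sub_inr_prgs a, map_sub, LinearMap.sub_apply,
      apply_skewOp_left B.isManinProj_inr_comp_prgs eD.pairing_Ad, skewOp_inr_comp_prgs eD hφ,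
      B.pairing_inr_inr, sub_zero]

end Double

end PoissonLie

end

theorem mainTheorem9
    {𝔤 : Type*} [LieRing 𝔤] [LieAlgebra ℝ 𝔤] [FiniteDimensional ℝ 𝔤] (B : LieBialgebra 𝔤)
    {ED : Type*} [NormedAddCommGroup ED] [NormedSpace ℝ ED] [FiniteDimensional ℝ ED]
    {D : Type*} [TopologicalSpace D] [ChartedSpace ED D] [Group D] [LieGroup 𝓘(ℝ, ED) ∞ D]
    {EG : Type*} [NormedAddCommGroup EG] [NormedSpace ℝ EG] [FiniteDimensional ℝ EG]
    {G : Type*} [TopologicalSpace G] [ChartedSpace EG G] [Group G] [LieGroup 𝓘(ℝ, EG) ∞ G]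
    {ES : Type*} [NormedAddCommGroup ES] [NormedSpace ℝ ES] [FiniteDimensional ℝ ES]
    {Gs : Type*} [TopologicalSpace Gs] [ChartedSpace ES Gs] [Group Gs] [LieGroup 𝓘(ℝ, ES) ∞ Gs]
    (eD : PoissonLie.QuadraticIdent B ED D)
    (eG : PoissonLie.LieAlgebraIdent EG G 𝔤)
    (eS : PoissonLie.LieAlgebraIdent ES Gs B.DualAlg)
    (φG : G →* D) (hφG : PoissonLie.IsIntegration eG eD.toLieAlgebraIdent B.inl φG)
    (φS : Gs →* D) (hφS : PoissonLie.IsIntegration eS eD.toLieAlgebraIdent B.inr φS)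
    {ι : Type*} [Fintype ι] (u : Module.Basis ι ℝ 𝔤) :
    PoissonLie.IsPoissonLieGroup (PoissonLie.piG eD eG φG) ∧
    PoissonLie.IsPoissonLieGroup (PoissonLie.piGs eD eS φS) ∧
    PoissonLie.IsPoissonLieGroupHom (PoissonLie.piG eD eG φG) (PoissonLie.piD eD u) φG ∧
    PoissonLie.IsPoissonLieGroupHom (PoissonLie.piGs eD eS φS) (-PoissonLie.piD eD u) φS ∧
    PoissonLie.HasLieBialgebra eG (PoissonLie.piG eD eG φG) B ∧
    PoissonLie.IsDualPoissonLieGroup B eG (PoissonLie.piG eD eG φG) eS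
      (PoissonLie.piGs eD eS φS) := by
  have : CompleteSpace ED := FiniteDimensional.complete ℝ ED
  have hD := PoissonLie.isInducedBivector_piD eD u
  have hD' := B.id_sub_inl_comp_prg ▸ hD.neg
  have hG := PoissonLie.isInducedBivector_piG eD eG φG hφG
  have hS := PoissonLie.isInducedBivector_piGs eD eS φS hφS
  have hB : PoissonLie.HasLieBialgebra eG (PoissonLie.piG eD eG φG) B :=
    hG.hasLieBialgebra (fun _ => map_zero B.inl) B.pairing_inr_toDual_symm_inl
      B.cobracket_eq_neg_pairing_lie
  have hB' : PoissonLie.HasLieBialgebra eS (PoissonLie.piGs eD eS φS) B.dual :=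
    hS.hasLieBialgebra (fun _ => map_zero B.inr) B.pairing_inl_ofBidual_inr
      B.dual_cobracket_eq_neg_pairing_lie
  exact ⟨hG.isPoissonLieGroup, hS.isPoissonLieGroup,
    ⟨hG.isPoissonLieGroup, hD.isPoissonLieGroup, hφG.smooth, hG.map_apply hD⟩,
    ⟨hS.isPoissonLieGroup, hD'.isPoissonLieGroup, hφS.smooth, hS.map_apply hD'⟩,
    hB, ⟨hG.isPoissonLieGroup, hB, hS.isPoissonLieGroup, hB'⟩⟩
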